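/- **Setting.** Let $K$ be a finite set, and consider countably many "collections", each with Hilbert space $\mathbb C^K\otimes\mathbb C^K$ (a top and a bottom tensor factor) and with a unit vector $\rho\in\mathbb C^K\otimes\mathbb C^K$. Let $\mathcal H(\rho)$ be the completion of the pre-Hilbert space of all vectors $\psi\otimes\rho\otimes\rho\otimes\cdots$, with $\psi$ in the tensor product of the first $n$ collections for some $n$ (where $\psi$ is identified with $\psi\otimes\rho$), and let $\Omega_\rho=\rho\otimes\rho\otimes\cdots$. Let $A^{\rm top}(\rho)$ (resp. $A^{\rm bot}(\rho)$) be the set of bounded operators $a\otimes I\otimes I\otimes\cdots$ on $\mathcal H(\rho)$ where, for some $N$, $a$ is an arbitrary linear operator acting on the top (resp. bottom) factors of the first $N$ collections and trivially on their bottom (resp. top) factors. *Code space:* $K=\{0,1,2\}$ and $\rho=|\lambda\rangle=\frac1{\sqrt3}(|00\rangle+|11\rangle+|22\rangle)$. *Physical space:* $K=\{0,1,2\}^2$; each collection consists of four qutrits $a,b$ (top) and $d,e$ (bottom), and $\rho=|\lambda\rangle_{ad}|\lambda\rangle_{be}$. Write $\mathcal H_{code},\mathcal H_{phys}$ for the two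 Hilbert spaces and $A^{\rm top}_{code}$, $A^{\rm bot}_{code}$, $A^{\rm top}_{phys}$, $A^{\rm bot}_{phys}$ for the sets of operators, and let $M_{code}$ and $M_{phys}$ be the closures of $A^{\rm top}_{code}$ and $A^{\rm top}_{phys}$ in the strong operator topology. Primes denote commutants. A von Neumann algebra $M\subset\mathcal B(\mathcal H)$ is a *factor* if $M\cap M'=\mathbb C I$. It is *hyperfinite* if $M=(\bigcup_n M_n)''$ for an increasing sequence $M_1\subset M_2\subset\cdots$ of finite-dimensional von Neumann subalgebras of $M$. A factor $M$ is of *type II$_1$* if it is infinite-dimensional and admits a non-zero ultraweakly continuous linear functional $\mathrm{tr}$ with $\mathrm{tr}(xy)=\mathrm{tr}(yx)$ and $\mathrm{tr}(x^\dagger x)\ge0$ for all $x,y\in M$. **Theorem.** $M_{code}$ and $M_{phys}$ are von Neumann algebras, and 1. $M_{code}'$ is the strong closure of $A^{\rm bot}_{code}$, and $M_{phys}'$ is the strong closure of $A^{\rm bot}_{phys}$. 2. $M_{code}$, $M_{code}'$, $M_{phys}$ and $M_{phys}'$ are factors. 3. For $M=M_{code}$ or $M_{code}'$ with $\Omega=|\lambda\lambda\cdots\rangle\in\mathcal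 H_{code}$, and for $M=M_{phys}$ or $M_{phys}'$ with $\Omega=\Omega_\rho\in\mathcal H_{phys}$, the functional $T(x)=\langle\Omega|x|\Omega\rangle$ on $M$ is positive ($T(x^\dagger x)\ge0$ and $T(x^\dagger)=\overline{T(x)}$), normalized ($T(I)=1$), faithful ($T(x^\dagger x)=0$ implies $x=0$), ultraweakly continuous, and tracial ($T(xy)=T(yx)$). Moreover, every ultraweakly continuous linear functional $\tau$ on $M$ with $\tau(I)=1$ and $\tau(xy)=\tau(yx)$ for all $x,y\in M$ equals $T$. 4. $M_{code}$, $M_{code}'$, $M_{phys}$ and $M_{phys}'$ are hyperfinite type II$_1$ factors. -/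

import Mathlib

open Filter Topology
open scoped ComplexOrder

noncomputable section

/-! ### The Hilbert space of infinitely many collections with a reference state

One collection has an orthonormal basis indexed by a finite type `κ` and a normalized reference
vector `ref`. The pre-Hilbert space consists of the states `ψ ⊗ ref ⊗ ref ⊗ ⋯` with `ψ` a state of
finitely many collections. -/

section Collections

variable {κ : Type} [Fintype κ]

/-- The Hilbert space of the first `n` collections. -/
abbrev FinSpace (κ : Type) [Fintype κ] (n : ℕ) : Type := EuclideanSpace ℂ (Fin n → κ)

/-- The map `ψ ↦ ψ ⊗ ref` from `n` to `n + 1` collections. -/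
def appendRef (ref : EuclideanSpace ℂ κ) (n : ℕ) : FinSpace κ n →ₗ[ℂ] FinSpace κ (n + 1) where
  toFun ψ := WithLp.toLp 2 fun t => ψ (Fin.init t) * ref (t (Fin.last n))
  map_add' ψ φ := by ext t; simp [add_mul]
  map_smul' c ψ := by ext t; simp [mul_assoc]

/-- Sequences `f` with `f n` a state of the first `n` collections and `f (n + 1) = f n ⊗ ref` for
all large `n`. Such a sequence represents the vector `f n ⊗ ref ⊗ ref ⊗ ⋯` (`n` large). -/
def preSubmodule (ref : EuclideanSpace ℂ κ) : Submodule ℂ ((n : ℕ) → FinSpace κ n) where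
  carrier := {f | ∀ᶠ n in atTop, f (n + 1) = appendRef ref n (f n)}
  add_mem' {f g} hf hg := by
    filter_upwards [hf, hg] with n h1 h2
    simp [h1, h2]
  zero_mem' := by simp
  smul_mem' c f hf := by
    filter_upwards [hf] with n h1
    simp [h1]

/-- The pre-Hilbert space (two sequences that agree for large `n` represent the same vector; their
difference has norm zero, so they become equal in the completion `ChainSpace`). -/
def PreSpace (ref : Metric.sphere (0 : EuclideanSpace ℂ κ) 1) : Type :=
  preSubmodule (ref : EuclideanSpace ℂ κ)

variable (ref : Metric.sphere (0 : EuclideanSpace ℂ κ) 1)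

instance : AddCommGroup (PreSpace ref) :=
  inferInstanceAs (AddCommGroup (preSubmodule (ref : EuclideanSpace ℂ κ)))

instance : Module ℂ (PreSpace ref) :=
  inferInstanceAs (Module ℂ (preSubmodule (ref : EuclideanSpace ℂ κ)))

variable {ref}

/-- The component in the first `n` collections, a linear map. -/
def PreSpace.comp (n : ℕ) : PreSpace ref →ₗ[ℂ] FinSpace κ n :=
  (LinearMap.proj n).comp (preSubmodule (ref : EuclideanSpace ℂ κ)).subtype

theorem PreSpace.eventually_comp (f : PreSpace ref) :
    ∀ᶠ n in atTop, PreSpace.comp (n + 1) f = appendRef (ref : EuclideanSpace ℂ κ) n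
      (PreSpace.comp n f) := f.2

theorem inner_appendRef (n : ℕ) (ψ φ : FinSpace κ n) :
    inner ℂ (appendRef (ref : EuclideanSpace ℂ κ) n ψ) (appendRef (ref : EuclideanSpace ℂ κ) n φ)
      = inner ℂ ψ φ := by
  have hr : ∑ c, (ref : EuclideanSpace ℂ κ) c * star ((ref : EuclideanSpace ℂ κ) c) = 1 := by
    have h1 : inner ℂ (ref : EuclideanSpace ℂ κ) (ref : EuclideanSpace ℂ κ) = (1 : ℂ) := by
      rw [inner_self_eq_norm_sq_to_K]
      simp
    rw [PiLp.inner_apply] at h1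
    exact h1
  rw [PiLp.inner_apply, PiLp.inner_apply,
    ← (Fin.snocEquiv (fun _ : Fin (n + 1) => κ)).sum_comp, Fintype.sum_prod_type, Finset.sum_comm]
  refine Finset.sum_congr rfl fun t _ => ?_
  have : ∀ c : κ, inner ℂ
      ((appendRef (ref : EuclideanSpace ℂ κ) n ψ) (Fin.snocEquiv (fun _ : Fin (n + 1) => κ) (c, t)))
      ((appendRef (ref : EuclideanSpace ℂ κ) n φ) (Fin.snocEquiv (fun _ : Fin (n + 1) => κ) (c, t)))
      = ((ref : EuclideanSpace ℂ κ) c * star ((ref : EuclideanSpace ℂ κ) c))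
        * inner ℂ (ψ t) (φ t) := by
    intro c
    simp [appendRef, Fin.snocEquiv]
    ring
  rw [Finset.sum_congr rfl fun c _ => this c, ← Finset.sum_mul, hr, one_mul]

/-- The inner product of `f n` and `g n`, which does not depend on `n` once `n` is large. -/
def preInner (f g : PreSpace ref) : ℂ :=
  limUnder atTop fun n => inner ℂ (PreSpace.comp n f) (PreSpace.comp n g)

theorem eventually_preInner (f g : PreSpace ref) :
    ∀ᶠ n in atTop, inner ℂ (PreSpace.comp n f) (PreSpace.comp n g) = preInner f g := by
  obtain ⟨N, hN⟩ := eventually_atTop.1 (f.eventually_comp.and g.eventually_comp)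
  have hc : ∀ n ≥ N, inner ℂ (PreSpace.comp n f) (PreSpace.comp n g)
      = (inner ℂ (PreSpace.comp N f) (PreSpace.comp N g) : ℂ) := by
    intro n hn
    induction n, hn using Nat.le_induction with
    | base => rfl
    | succ k hk ih => rw [(hN k hk).1, (hN k hk).2, inner_appendRef, ih]
  have ht : Tendsto (fun n => (inner ℂ (PreSpace.comp n f) (PreSpace.comp n g) : ℂ)) atTop
      (𝓝 (inner ℂ (PreSpace.comp N f) (PreSpace.comp N g))) :=
    tendsto_const_nhds.congr' ((eventually_ge_atTop N).mono fun n hn => (hc n hn).symm)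
  filter_upwards [eventually_ge_atTop N] with n hn
  rw [hc n hn, preInner, ht.limUnder_eq]

/-- The positive semidefinite inner product of the pre-Hilbert space. -/
abbrev preCore (ref : Metric.sphere (0 : EuclideanSpace ℂ κ) 1) :
    PreInnerProductSpace.Core ℂ (PreSpace ref) where
  inner f g := preInner f g
  conj_inner_symm f g := by
    obtain ⟨n, h1, h2⟩ := ((eventually_preInner f g).and (eventually_preInner g f)).exists
    rw [← h1, ← h2, inner_conj_symm]
  re_inner_nonneg f := by
    obtain ⟨n, h1⟩ := (eventually_preInner f f).exists
    rw [← h1]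
    exact inner_self_nonneg
  add_left f g h := by
    obtain ⟨n, h1, h2, h3⟩ := ((eventually_preInner (f + g) h).and
      ((eventually_preInner f h).and (eventually_preInner g h))).exists
    rw [← h1, ← h2, ← h3, map_add, inner_add_left]
  smul_left f g c := by
    obtain ⟨n, h1, h2⟩ := ((eventually_preInner (c • f) g).and (eventually_preInner f g)).exists
    rw [← h1, ← h2, map_smul, inner_smul_left]

instance : SeminormedAddCommGroup (PreSpace ref) :=
  InnerProductSpace.Core.toSeminormedAddCommGroup (c := preCore ref)

instance : InnerProductSpace ℂ (PreSpace ref) := InnerProductSpace.ofCore (preCore ref)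

theorem PreSpace.eventually_norm (f : PreSpace ref) : ∀ᶠ n in atTop, ‖PreSpace.comp n f‖ = ‖f‖ := by
  filter_upwards [eventually_preInner f f] with n hn
  have h : (inner ℂ f f : ℂ) = inner ℂ (PreSpace.comp n f) (PreSpace.comp n f) := hn.symm
  rw [@norm_eq_sqrt_re_inner ℂ, @norm_eq_sqrt_re_inner ℂ _ _ _ _ f, h]

/-- The Hilbert space of all collections: the completion of the pre-Hilbert space. -/
abbrev ChainSpace (ref : Metric.sphere (0 : EuclideanSpace ℂ κ) 1) : Type :=
  UniformSpace.Completion (PreSpace ref)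

/-- The vector `ref ⊗ ref ⊗ ⋯` of the pre-Hilbert space. -/
def preRefVector (ref : Metric.sphere (0 : EuclideanSpace ℂ κ) 1) : PreSpace ref :=
  ⟨fun _ => WithLp.toLp 2 fun t => ∏ k, (ref : EuclideanSpace ℂ κ) (t k), by
    refine Eventually.of_forall fun n => ?_
    ext t
    simp [appendRef, Fin.prod_univ_castSucc, Fin.init]⟩

/-- The vector `ref ⊗ ref ⊗ ⋯` of the Hilbert space. -/
def refVector (ref : Metric.sphere (0 : EuclideanSpace ℂ κ) 1) : ChainSpace ref :=
  (preRefVector ref : ChainSpace ref)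

/-! ### Operators on finitely many collections -/

/-- Replace the first `N` entries of `t` by `q`. -/
def overwrite {N n : ℕ} (q : Fin N → κ) (t : Fin n → κ) : Fin n → κ :=
  fun k => if h : (k : ℕ) < N then q ⟨k, h⟩ else t k

/-- The operator `A ⊗ I ⊗ ⋯ ⊗ I` on `n` collections, where `A` acts on the first `N` of them
(only used for `N ≤ n`). -/
def finOp {N : ℕ} (A : Matrix (Fin N → κ) (Fin N → κ) ℂ) (n : ℕ) :
    FinSpace κ n →ₗ[ℂ] FinSpace κ n :=
  if h : N ≤ n then
    { toFun := fun ψ => WithLp.toLp 2 fun t =>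
        ∑ q, A (fun k => t (Fin.castLE h k)) q * ψ (overwrite q t)
      map_add' := fun ψ φ => by ext t; simp [mul_add, Finset.sum_add_distrib]
      map_smul' := fun c ψ => by ext t; simp [Finset.mul_sum, mul_left_comm] }
  else 0

theorem finOp_apply {N n : ℕ} (A : Matrix (Fin N → κ) (Fin N → κ) ℂ) (h : N ≤ n)
    (ψ : FinSpace κ n) (t : Fin n → κ) :
    finOp A n ψ t = ∑ q, A (fun k => t (Fin.castLE h k)) q * ψ (overwrite q t) := by
  simp [finOp, h]


theorem finOp_appendRef {N n : ℕ} (r : EuclideanSpace ℂ κ)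
    (A : Matrix (Fin N → κ) (Fin N → κ) ℂ) (h : N ≤ n) (ψ : FinSpace κ n) :
    finOp A (n + 1) (appendRef r n ψ) = appendRef r n (finOp A n ψ) := by
  ext t
  rw [finOp_apply A (h.trans n.le_succ)]
  simp only [appendRef, LinearMap.coe_mk, AddHom.coe_mk]
  rw [finOp_apply A h, Finset.sum_mul]
  refine Finset.sum_congr rfl fun q _ => ?_
  have h1 : overwrite q t (Fin.last n) = t (Fin.last n) := by
    simp [overwrite, h]
  have h2 : Fin.init (overwrite q t) = overwrite q (Fin.init t) := by
    ext k
    simp [overwrite, Fin.init]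
  rw [h1, h2, mul_assoc]
  rfl

theorem sum_overwrite {N n : ℕ} (h : N ≤ n) (g : (Fin n → κ) → ℝ) :
    ∑ t, ∑ q : Fin N → κ, g (overwrite q t) = Fintype.card (Fin N → κ) * ∑ t, g t := by
  let e : (Fin n → κ) × (Fin N → κ) → (Fin n → κ) × (Fin N → κ) :=
    fun x => (overwrite x.2 x.1, fun k => x.1 (Fin.castLE h k))
  have he : Function.Involutive e := by
    rintro ⟨t, q⟩
    ext k
    · by_cases hk : (k : ℕ) < N <;> simp [e, overwrite, hk]
    · simp [e, overwrite]
  rw [← Fintype.sum_prod_type' (fun t (q : Fin N → κ) => g (overwrite q t))]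
  calc ∑ x : (Fin n → κ) × (Fin N → κ), g (overwrite x.2 x.1)
      = ∑ x : (Fin n → κ) × (Fin N → κ), g ((he.toPerm e) x).1 := rfl
    _ = ∑ x : (Fin n → κ) × (Fin N → κ), g x.1 :=
        Equiv.sum_comp (he.toPerm e) fun x : (Fin n → κ) × (Fin N → κ) => g x.1
    _ = _ := by rw [Fintype.sum_prod_type]; simp [Finset.mul_sum]

/-- An upper bound for the norms of all `A ⊗ I ⊗ ⋯ ⊗ I`. -/
def opBound {N : ℕ} (A : Matrix (Fin N → κ) (Fin N → κ) ℂ) : ℝ :=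
  √((∑ p, ∑ q, ‖A p q‖ ^ 2) * Fintype.card (Fin N → κ))

theorem norm_finOp_le {N n : ℕ} (A : Matrix (Fin N → κ) (Fin N → κ) ℂ) (h : N ≤ n)
    (ψ : FinSpace κ n) : ‖finOp A n ψ‖ ≤ opBound A * ‖ψ‖ := by
  rw [opBound, EuclideanSpace.norm_eq, EuclideanSpace.norm_eq,
    ← Real.sqrt_mul (by positivity)]
  refine Real.sqrt_le_sqrt ?_
  rw [mul_assoc, ← sum_overwrite h, Finset.mul_sum]
  refine Finset.sum_le_sum fun t _ => ?_
  rw [finOp_apply A h]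
  calc ‖∑ q, A (fun k => t (Fin.castLE h k)) q * ψ (overwrite q t)‖ ^ 2
      ≤ (∑ q, ‖A (fun k => t (Fin.castLE h k)) q‖ * ‖ψ (overwrite q t)‖) ^ 2 := by
        gcongr
        exact (norm_sum_le _ _).trans (le_of_eq (by simp))
    _ ≤ (∑ q, ‖A (fun k => t (Fin.castLE h k)) q‖ ^ 2) * ∑ q, ‖ψ (overwrite q t)‖ ^ 2 :=
        Finset.sum_mul_sq_le_sq_mul_sq _ _ _
    _ ≤ _ := by
        refine mul_le_mul_of_nonneg_right ?_ (by positivity)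
        exact Finset.single_le_sum (f := fun p => ∑ q, ‖A p q‖ ^ 2)
          (fun p _ => by positivity) (Finset.mem_univ _)

/-- The operator `A ⊗ I ⊗ I ⊗ ⋯` on the pre-Hilbert space, where `A` acts on the first `N`
collections. -/
def preOp {N : ℕ} (A : Matrix (Fin N → κ) (Fin N → κ) ℂ) : PreSpace ref →L[ℂ] PreSpace ref :=
  LinearMap.mkContinuous
    { toFun := fun f => ⟨fun n => finOp A n (PreSpace.comp n f), by
        filter_upwards [f.eventually_comp, eventually_ge_atTop N] with n h1 h2
        rw [h1, finOp_appendRef _ A h2]⟩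
      map_add' := fun f g => Subtype.ext (funext fun n => by simp; rfl)
      map_smul' := fun c f => Subtype.ext (funext fun n => by simp; rfl) }
    (opBound A) fun f => by
      obtain ⟨n, h1, h2, h3⟩ := (f.eventually_norm.and
        ((PreSpace.eventually_norm (ref := ref) ⟨fun n => finOp A n (PreSpace.comp n f), by
          filter_upwards [f.eventually_comp, eventually_ge_atTop N] with n h1 h2
          rw [h1, finOp_appendRef _ A h2]⟩).and (eventually_ge_atTop N))).exists
      rw [← h1]
      exact h2.symm.trans_le (norm_finOp_le A h3 _)

/-- The bounded operator `A ⊗ I ⊗ I ⊗ ⋯` on the Hilbert space, where `A` acts on the first `N`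
collections. -/
def localOp (ref : Metric.sphere (0 : EuclideanSpace ℂ κ) 1) {N : ℕ}
    (A : Matrix (Fin N → κ) (Fin N → κ) ℂ) : ChainSpace ref →L[ℂ] ChainSpace ref :=
  (preOp A : PreSpace ref →L[ℂ] PreSpace ref).completion

end Collections

/-! ### The top-row and bottom-row operators

From here on, each collection consists of a top and a bottom subsystem, whose bases are both
indexed by `K`; a basis vector of the collection is a pair (top, bottom). -/

section Rows

variable {K : Type} [Fintype K] [DecidableEq K]

/-- The matrix of `a ⊗ I`, where `a` acts on the top subsystems of the first `N` collections. -/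
def topMatrix {N : ℕ} (a : Matrix (Fin N → K) (Fin N → K) ℂ) :
    Matrix (Fin N → K × K) (Fin N → K × K) ℂ :=
  fun s t => if ∀ k, (s k).2 = (t k).2 then a (fun k => (s k).1) (fun k => (t k).1) else 0

/-- The matrix of `I ⊗ a`, where `a` acts on the bottom subsystems of the first `N` collections. -/
def bottomMatrix {N : ℕ} (a : Matrix (Fin N → K) (Fin N → K) ℂ) :
    Matrix (Fin N → K × K) (Fin N → K × K) ℂ :=
  fun s t => if ∀ k, (s k).1 = (t k).1 then a (fun k => (s k).2) (fun k => (t k).2) else 0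

/-- The operators that act nontrivially only on the top subsystems of finitely many collections. -/
def topOps (ref : Metric.sphere (0 : EuclideanSpace ℂ (K × K)) 1) :
    Set (ChainSpace ref →L[ℂ] ChainSpace ref) :=
  {x | ∃ (N : ℕ) (a : Matrix (Fin N → K) (Fin N → K) ℂ), x = localOp ref (topMatrix a)}

/-- The operators that act nontrivially only on the bottom subsystems of finitely many
collections. -/
def bottomOps (ref : Metric.sphere (0 : EuclideanSpace ℂ (K × K)) 1) :
    Set (ChainSpace ref →L[ℂ] ChainSpace ref) :=
  {x | ∃ (N : ℕ) (a : Matrix (Fin N → K) (Fin N → K) ℂ), x = localOp ref (bottomMatrix a)}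

end Rows

/-! ### The code and the physical Hilbert space -/

/-- The two-qutrit vector `|λ⟩ = (|00⟩ + |11⟩ + |22⟩) / √3`. -/
def lambdaVec : EuclideanSpace ℂ (Fin 3 × Fin 3) :=
  WithLp.toLp 2 fun s => if s.1 = s.2 then ((1 / √3 : ℝ) : ℂ) else 0

/-- The reference state `|λ⟩` of a pair of code qutrits (top, bottom). -/
def codeRef : Metric.sphere (0 : EuclideanSpace ℂ (Fin 3 × Fin 3)) 1 :=
  ⟨lambdaVec, by
    rw [mem_sphere_zero_iff_norm, EuclideanSpace.norm_eq, Real.sqrt_eq_one,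
      Fintype.sum_prod_type]
    simp [lambdaVec, Fin.sum_univ_three]
    norm_num⟩

/-- The reference state `|λ⟩_{ad} |λ⟩_{be}` of four physical qutrits `((a, b), (d, e))`, with
`a, b` in the top and `d, e` in the bottom row. -/
def physRef : Metric.sphere (0 : EuclideanSpace ℂ ((Fin 3 × Fin 3) × (Fin 3 × Fin 3))) 1 :=
  ⟨WithLp.toLp 2 fun s => lambdaVec (s.1.1, s.2.1) * lambdaVec (s.1.2, s.2.2), by
    rw [mem_sphere_zero_iff_norm, EuclideanSpace.norm_eq, Real.sqrt_eq_one]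
    have h : |√3|⁻¹ * |√3|⁻¹ = (1 / 3 : ℝ) := by
      rw [← mul_inv, abs_mul_abs_self, Real.mul_self_sqrt (by norm_num)]
      norm_num
    simp [lambdaVec, Fintype.sum_prod_type, Fin.sum_univ_three, h]
    norm_num⟩

/-- The Hilbert space of the code qutrits. -/
abbrev CodeSpace : Type := ChainSpace codeRef

/-- The Hilbert space of the physical qutrits. -/
abbrev PhysSpace : Type := ChainSpace physRef

/-! ### Von Neumann algebras -/

section VonNeumann

variable {H : Type*} [NormedAddCommGroup H] [InnerProductSpace ℂ H]

/-- The closure of a set of bounded operators in the strong operator topology. -/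
def strongClosure (S : Set (H →L[ℂ] H)) : Set (H →L[ℂ] H) :=
  {x | ContinuousLinearMap.toPointwiseConvergenceCLM ℂ (RingHom.id ℂ) H H x ∈
    closure (ContinuousLinearMap.toPointwiseConvergenceCLM ℂ (RingHom.id ℂ) H H '' S)}

/-- The ultraweak operator topology: the smallest topology containing the sets
`{P | ∑ i, |⟨η i, (P - O) ξ i⟩| < ε}` with `∑ i, (‖ξ i‖² + ‖η i‖²) < ∞`. -/
abbrev ultraweakTopology (H : Type*) [NormedAddCommGroup H] [InnerProductSpace ℂ H] :
    TopologicalSpace (H →L[ℂ] H) :=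
  TopologicalSpace.generateFrom
    {U | ∃ (O : H →L[ℂ] H) (ξ η : ℕ → H) (ε : ℝ),
      Summable (fun i => ‖ξ i‖ ^ 2 + ‖η i‖ ^ 2) ∧ 0 < ε ∧
      U = {P | ∑' i, ‖(inner ℂ (η i) ((P - O) (ξ i)) : ℂ)‖ < ε}}

variable [CompleteSpace H]

/-- A factor: the center consists of the scalar multiples of the identity. -/
def IsFactor (M : VonNeumannAlgebra H) : Prop :=
  (M : Set (H →L[ℂ] H)) ∩ (M.commutant : Set (H →L[ℂ] H)) = {x | ∃ c : ℂ, x = c • 1}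

/-- Linear functionals on a von Neumann algebra. -/
abbrev Functional (M : VonNeumannAlgebra H) : Type _ := M.toStarSubalgebra →ₗ[ℂ] ℂ

/-- Normality: continuity in the ultraweak topology. -/
def IsNormal {M : VonNeumannAlgebra H} (τ : Functional M) : Prop :=
  @Continuous M.toStarSubalgebra ℂ
    ((ultraweakTopology H).induced (Subtype.val : M.toStarSubalgebra → H →L[ℂ] H)) _ τ

/-- The trace property. -/
def IsTracial {M : VonNeumannAlgebra H} (τ : Functional M) : Prop :=
  ∀ x y, τ (x * y) = τ (y * x)

/-- Positivity. -/
def IsPositiveFunctional {M : VonNeumannAlgebra H} (τ : Functional M) : Prop :=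
  ∀ x, 0 ≤ τ (star x * x) ∧ τ (star x) = star (τ x)

/-- Faithfulness. -/
def IsFaithfulFunctional {M : VonNeumannAlgebra H} (τ : Functional M) : Prop :=
  ∀ x, τ (star x * x) = 0 → x = 0

/-- The functional `x ↦ ⟨Ω, x Ω⟩`. -/
def vectorFunctional (M : VonNeumannAlgebra H) (Ω : H) : Functional M where
  toFun x := inner ℂ Ω ((x : H →L[ℂ] H) Ω)
  map_add' x y := by simp
  map_smul' c x := by simp

/-- `T` is a positive, normalized, faithful, normal trace, and it is the only normalized normal
trace. -/
def IsUniqueNormalTrace {M : VonNeumannAlgebra H} (T : Functional M) : Prop :=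
  IsPositiveFunctional T ∧ T 1 = 1 ∧ IsFaithfulFunctional T ∧ IsNormal T ∧ IsTracial T ∧
    ∀ τ : Functional M, IsNormal τ → IsTracial τ → τ 1 = 1 → τ = T

/-- A type II₁ factor: an infinite-dimensional factor with a non-zero functional `tr` that is
tracial, satisfies `0 ≤ tr (x* x)`, and is ultraweakly continuous. -/
def IsTypeII1Factor (M : VonNeumannAlgebra H) : Prop :=
  IsFactor M ∧ ¬ FiniteDimensional ℂ M.toStarSubalgebra ∧
    ∃ tr : Functional M, tr ≠ 0 ∧ IsTracial tr ∧ (∀ x, 0 ≤ tr (star x * x)) ∧ IsNormal tr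

/-- Hyperfiniteness: `M = (⋃ₙ Mₙ)''` for an increasing sequence of finite-dimensional von Neumann
subalgebras `Mₙ` of `M`. -/
def IsHyperfinite (M : VonNeumannAlgebra H) : Prop :=
  ∃ A : ℕ → VonNeumannAlgebra H,
    (∀ n, FiniteDimensional ℂ (A n).toStarSubalgebra) ∧ (∀ n, A n ≤ A (n + 1)) ∧
    (∀ n, A n ≤ M) ∧
    (M : Set (H →L[ℂ] H)) =
      Set.centralizer (Set.centralizer (⋃ n, (A n : Set (H →L[ℂ] H))))

end VonNeumann

end

/-! ### Increasing sequences of matrix algebras with a cyclic trace vector -/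

section TracialPair

/-! The reference vector Ω is maximally entangled between the rows, and only three consequences
matter: a top operator a acts on Ω as the bottom operator given by the transpose of a; ⟨Ω, aΩ⟩ is a
multiple of the matrix trace of a; and the vectors aΩ are dense. `IsTracialPair` records these for
two commuting increasing sequences of matrix algebras π, σ. Its axioms are symmetric in π and σ, so
each result also holds for the other row.

The engine is `exists_approx`. Let x commute with all of σ, and let P be the projection onto the
finite-dimensional space V = π_n Ω = σ_n Ω. Choose a in π_n with aΩ = PxΩ. Since x, a and P commute
with σ_n, a agrees with Px on all of V = σ_n Ω, so ‖a‖ ≤ ‖x‖ there; as π_n acts faithfully on V, the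
bound holds on H. Bounded convergence on the dense set σΩ then gives strong convergence everywhere.

Hence the commutant of σ is the strong closure of π, without a density theorem, and the two closures
are each other's commutants. The trace property passes to strong limits. Bounded strong convergence
is also ultraweak, so a normal trace is determined on the matrix algebras, where it is unique. A
central x gives the tracial functional a ↦ ⟨Ω, xaΩ⟩, a multiple of the trace, which forces xΩ = cΩ
and so x = c.

`isTracialPair_rows` verifies the axioms for any reference vector that is a multiple of ∑ |kk⟩. The
physical vector has this form once the pairs (a, b) and (d, e) are read as single indices. -/

open scoped Matrix.Norms.L2Operator in
/-- Two faithful representations of a matrix algebra give the same operator norms. -/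
theorem norm_eq_norm_of_injective {V W m : Type*} [NormedAddCommGroup V] [InnerProductSpace ℂ V]
    [CompleteSpace V] [NormedAddCommGroup W] [InnerProductSpace ℂ W] [CompleteSpace W]
    [Fintype m] [DecidableEq m] (f : Matrix m m ℂ →⋆ₐ[ℂ] (V →L[ℂ] V))
    (g : Matrix m m ℂ →⋆ₐ[ℂ] (W →L[ℂ] W)) (hf : Function.Injective f)
    (hg : Function.Injective g) (a : Matrix m m ℂ) : ‖f a‖ = ‖g a‖ :=
  (NonUnitalStarAlgHom.norm_map f hf a).trans (NonUnitalStarAlgHom.norm_map g hg a).symm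

variable {H : Type*} [NormedAddCommGroup H] [InnerProductSpace ℂ H] [CompleteSpace H]
  {ι : ℕ → Type*} [∀ n, Fintype (ι n)] [∀ n, DecidableEq (ι n)]

/-- The union of the ranges of the representations `π n`. -/
def localAlgebra (π : ∀ n, Matrix (ι n) (ι n) ℂ →⋆ₐ[ℂ] (H →L[ℂ] H)) : Set (H →L[ℂ] H) :=
  ⋃ n, Set.range (π n)

/-- Two commuting increasing sequences of matrix algebras on `H` which produce the same vectors
from the unit vector `Ω`; these vectors are dense, and `Ω` implements the trace. -/
structure IsTracialPair (Ω : H) (π σ : ∀ n, Matrix (ι n) (ι n) ℂ →⋆ₐ[ℂ] (H →L[ℂ] H)) : Prop where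
  norm_eq_one : ‖Ω‖ = 1
  exists_succ_left : ∀ n a, ∃ b, π (n + 1) b = π n a
  exists_succ_right : ∀ n a, ∃ b, σ (n + 1) b = σ n a
  commute : ∀ n a b, Commute (π n a) (σ n b)
  exists_right : ∀ n a, ∃ b, σ n b Ω = π n a Ω
  exists_left : ∀ n b, ∃ a, π n a Ω = σ n b Ω
  dense : Dense {ξ | ∃ n a, π n a Ω = ξ}
  trace_left : ∀ n, ∃ k : ℂ, ∀ a, inner ℂ Ω (π n a Ω) = k * a.trace
  trace_right : ∀ n, ∃ k : ℂ, ∀ a, inner ℂ Ω (σ n a Ω) = k * a.trace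
  exists_lt_card : ∀ m, ∃ n, m < Fintype.card (ι n)

namespace IsTracialPair

variable {Ω : H} {π σ : ∀ n, Matrix (ι n) (ι n) ℂ →⋆ₐ[ℂ] (H →L[ℂ] H)}

theorem symm (h : IsTracialPair Ω π σ) : IsTracialPair Ω σ π where
  norm_eq_one := h.norm_eq_one
  exists_succ_left := h.exists_succ_right
  exists_succ_right := h.exists_succ_left
  commute n a b := (h.commute n b a).symm
  exists_right := h.exists_left
  exists_left := h.exists_right
  dense := by
    refine h.dense.mono ?_
    rintro _ ⟨n, a, rfl⟩
    obtain ⟨b, hb⟩ := h.exists_right n a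
    exact ⟨n, b, hb⟩
  trace_left := h.trace_right
  trace_right := h.trace_left
  exists_lt_card := h.exists_lt_card

theorem exists_le_left (h : IsTracialPair Ω π σ) {m n : ℕ} (hmn : m ≤ n) (a) :
    ∃ b, π n b = π m a := by
  induction n, hmn using Nat.le_induction with
  | base => exact ⟨a, rfl⟩
  | succ k _ ih =>
    obtain ⟨b, hb⟩ := ih
    obtain ⟨c, hc⟩ := h.exists_succ_left k b
    exact ⟨c, hc.trans hb⟩

theorem commute_of_ne (h : IsTracialPair Ω π σ) (m n a b) : Commute (π m a) (σ n b) := by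
  obtain ⟨a', ha⟩ := h.exists_le_left (le_max_left m n) a
  obtain ⟨b', hb⟩ := h.symm.exists_le_left (le_max_right m n) b
  rw [← ha, ← hb]
  exact h.commute _ _ _

theorem inner_self (h : IsTracialPair Ω π σ) : inner ℂ Ω Ω = (1 : ℂ) := by
  simp [inner_self_eq_norm_sq_to_K, h.norm_eq_one]

/-- ‖aΩ‖² is k times the trace of a*a, and k ≠ 0 because the same formula at a = 1 gives ‖Ω‖² = 1.
-/
theorem injective (h : IsTracialPair Ω π σ) (n) {a} (ha : π n a Ω = 0) : a = 0 := by
  obtain ⟨k, hk⟩ := h.trace_left n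
  have hk0 : k ≠ 0 := by
    rintro rfl
    have := hk 1
    rw [zero_mul, map_one, one_apply_eq_self, h.inner_self] at this
    exact one_ne_zero this
  have := hk (star a * a)
  rw [map_mul, mul_apply_eq_comp, ha, map_zero, inner_zero_right] at this
  rw [zero_eq_mul, or_iff_right hk0] at this
  exact Matrix.trace_conjTranspose_mul_self_eq_zero_iff.1 this

/-- An operator in the commutant of the second algebra is determined by its value at `Ω`. -/
theorem ext_of_commutant (h : IsTracialPair Ω π σ) {x y : H →L[ℂ] H}
    (hx : ∀ n b, Commute (σ n b) x) (hy : ∀ n b, Commute (σ n b) y) (hxy : x Ω = y Ω) :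
    x = y := by
  refine DFunLike.coe_injective (x.continuous.ext_on h.symm.dense y.continuous ?_)
  rintro _ ⟨n, b, rfl⟩
  have h1 := congr($((hx n b).eq) Ω)
  have h2 := congr($((hy n b).eq) Ω)
  simp only [mul_apply_eq_comp] at h1 h2
  rw [← h1, ← h2, hxy]

variable (Ω π) in
/-- The space of the vectors `π n a Ω`. -/
def localSpace (n : ℕ) : Submodule ℂ H :=
  ((LinearMap.applyₗ Ω).comp ((ContinuousLinearMap.coeLM ℂ).comp
    ((π n : Matrix (ι n) (ι n) ℂ →ₐ[ℂ] (H →L[ℂ] H)).toLinearMap))).range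

theorem mem_localSpace {n : ℕ} {ξ : H} : ξ ∈ localSpace Ω π n ↔ ∃ a, π n a Ω = ξ := Iff.rfl

instance (n : ℕ) : FiniteDimensional ℂ (localSpace Ω π n) :=
  LinearMap.finiteDimensional_range _

theorem localSpace_right (h : IsTracialPair Ω π σ) (n : ℕ) :
    localSpace Ω σ n = localSpace Ω π n := by
  ext ξ
  simp only [mem_localSpace]
  constructor
  · rintro ⟨b, rfl⟩; exact h.exists_left n b
  · rintro ⟨b, rfl⟩; exact h.exists_right n b

theorem apply_mem_localSpace {n : ℕ} (a) {ξ : H} (hξ : ξ ∈ localSpace Ω π n) :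
    π n a ξ ∈ localSpace Ω π n := by
  obtain ⟨b, rfl⟩ := hξ
  exact ⟨a * b, by simp⟩

/-- The projection to `localSpace Ω π n` commutes with the `n`-th algebra. -/
theorem commute_starProjection (n : ℕ) (a) :
    Commute (π n a) ((localSpace Ω π n).starProjection) := by
  set V := localSpace Ω π n
  have key : ∀ a ξ, V.starProjection (π n a (V.starProjection ξ)) = π n a (V.starProjection ξ) :=
    fun a ξ => Submodule.starProjection_eq_self_iff.2
      (apply_mem_localSpace a (Submodule.starProjection_apply_mem _ _))
  have key' : ∀ a, V.starProjection * (π n a * V.starProjection) = π n a * V.starProjection :=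
    fun a => by ext ξ; exact key a ξ
  have hs : star V.starProjection = V.starProjection :=
    (isSelfAdjoint_starProjection V).star_eq
  -- Invariance under a gives PaP = aP; the adjoint of the same identity for a* gives PaP = Pa.
  have h1 := congr(star $(key' (star a)))
  simp only [star_mul, map_star, star_star, hs] at h1
  rw [commute_iff_eq, ← key' a, ← mul_assoc, h1]

/-- The restriction of the `n`-th algebra to `localSpace Ω π n`. -/
noncomputable def localRep (Ω : H) (π : ∀ n, Matrix (ι n) (ι n) ℂ →⋆ₐ[ℂ] (H →L[ℂ] H)) (n : ℕ) :
    Matrix (ι n) (ι n) ℂ →⋆ₐ[ℂ] (localSpace Ω π n →L[ℂ] localSpace Ω π n) where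
  toFun a := ((π n a).comp (localSpace Ω π n).subtypeL).codRestrict _
    fun ξ => apply_mem_localSpace a ξ.2
  map_one' := by ext; simp
  map_mul' a b := by ext; simp; rfl
  map_zero' := by ext; simp
  map_add' a b := by ext; simp; rfl
  commutes' c := by ext; simp [Algebra.algebraMap_eq_smul_one]
  map_star' a := by
    rw [ContinuousLinearMap.star_eq_adjoint, ContinuousLinearMap.eq_adjoint_iff]
    intro ξ η
    simp [map_star, ContinuousLinearMap.star_eq_adjoint, ContinuousLinearMap.adjoint_inner_left]
    rfl

/-- Ω lies in the local space and separates the matrix algebra, so the restriction is still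
faithful. A norm bound checked on the local space therefore holds on H. -/
theorem norm_eq_norm_localRep (h : IsTracialPair Ω π σ) (n : ℕ) (a) :
    ‖π n a‖ = ‖localRep Ω π n a‖ := by
  refine norm_eq_norm_of_injective (π n) (localRep Ω π n) ?_ ?_ a
  · rw [injective_iff_map_eq_zero]
    intro a ha
    exact h.injective n congr($ha Ω)
  · rw [injective_iff_map_eq_zero]
    intro a ha
    have hΩ : Ω ∈ localSpace Ω π n := ⟨1, by simp⟩
    exact h.injective n congr(($ha ⟨Ω, hΩ⟩ : H))

/-- Every operator in the commutant of the second algebra is approximated by a bounded sequence of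
the first algebra. -/
theorem exists_approx (h : IsTracialPair Ω π σ) {x : H →L[ℂ] H}
    (hx : ∀ n b, Commute (σ n b) x) :
    ∃ a : ∀ n, Matrix (ι n) (ι n) ℂ, (∀ n, ‖π n (a n)‖ ≤ ‖x‖) ∧
      ∀ ξ, Tendsto (fun n => π n (a n) ξ) atTop (𝓝 (x ξ)) := by
  have hex : ∀ n, ∃ a, π n a Ω = (localSpace Ω π n).starProjection (x Ω) := fun n =>
    mem_localSpace.1 (Submodule.starProjection_apply_mem _ _)
  choose a ha using hex
  -- Both algebras generate the same local space from Ω, so its projection commutes with σ as well.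
  have hcomm : ∀ n b, Commute (σ n b) ((localSpace Ω π n).starProjection) := fun n b => by
    have := commute_starProjection (Ω := Ω) (π := σ) n b
    simp only [h.localSpace_right n] at this
    exact this
  -- Write ξ = σ(b)Ω and pull σ(b) out to the left: the claim reduces to the choice of `a n` at Ω.
  have hloc : ∀ n, ∀ ξ ∈ localSpace Ω π n,
      π n (a n) ξ = (localSpace Ω π n).starProjection (x ξ) := by
    intro n ξ hξ
    rw [← h.localSpace_right n] at hξ
    obtain ⟨b, rfl⟩ := mem_localSpace.1 hξ
    have h1 := congr($((h.commute n (a n) b).eq) Ω)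
    have h2 := congr($((hcomm n b).eq) (x Ω))
    have h3 := congr($((hx n b).eq) Ω)
    simp only [mul_apply_eq_comp] at h1 h2 h3
    rw [h1, ha, h2, h3]
  have hbound : ∀ n, ‖π n (a n)‖ ≤ ‖x‖ := by
    intro n
    rw [h.norm_eq_norm_localRep]
    refine ContinuousLinearMap.opNorm_le_bound _ (norm_nonneg _) fun ξ => ?_
    change ‖π n (a n) ξ‖ ≤ _
    rw [hloc n ξ ξ.2]
    exact ((localSpace Ω π n).norm_starProjection_apply_le _).trans (x.le_opNorm _)
  refine ⟨a, hbound, ?_⟩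
  have hmono : Monotone (localSpace Ω π) := by
    intro m n hmn ξ
    rintro ⟨c, rfl⟩
    obtain ⟨d, hd⟩ := h.exists_le_left hmn c
    exact ⟨d, congr($hd Ω)⟩
  have hΩ : Tendsto (fun n => π n (a n) Ω) atTop (𝓝 (x Ω)) := by
    simp only [ha]
    refine Submodule.starProjection_tendsto_self _ hmono _ ?_
    rintro ξ -
    refine closure_mono ?_ (h.dense ξ)
    rintro _ ⟨n, c, rfl⟩
    exact Submodule.mem_iSup_of_mem n ⟨c, rfl⟩
  intro ξ
  have hd := h.symm.dense
  rw [Metric.tendsto_atTop]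
  intro ε hε
  -- The radius makes `x` and every `π m (a m)` move the error by at most ε/3; the added 1 covers `x
  -- = 0`.
  obtain ⟨_, hη, n, b, rfl⟩ := Metric.dense_iff.1 hd ξ (ε / (3 * (‖x‖ + 1))) (by positivity)
  have hη' : ‖ξ - σ n b Ω‖ < ε / (3 * (‖x‖ + 1)) := by
    rwa [Metric.mem_ball', dist_eq_norm] at hη
  -- Apply the continuous operator σ(b) to the convergence at Ω; it commutes with `x` and with all
  -- the approximants.
  have hb : Tendsto (fun m => π m (a m) (σ n b Ω)) atTop (𝓝 (x (σ n b Ω))) := by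
    have h1 := ((σ n b).continuous.tendsto _).comp hΩ
    have h2 := congr($((hx n b).eq) Ω)
    simp only [mul_apply_eq_comp] at h2
    rw [h2] at h1
    refine h1.congr fun m => ?_
    exact congr($((h.commute_of_ne m n (a m) b).eq.symm) Ω)
  obtain ⟨N, hN⟩ := Metric.tendsto_atTop.1 hb (ε / 3) (by positivity)
  refine ⟨N, fun m hm => ?_⟩
  have hlt : ‖x‖ * (ε / (3 * (‖x‖ + 1))) ≤ ε / 3 := by
    rw [mul_div_assoc', div_le_div_iff₀ (by positivity) (by positivity)]
    nlinarith [norm_nonneg x]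
  have e1 : ‖π m (a m) (ξ - σ n b Ω)‖ ≤ ε / 3 :=
    ((π m (a m)).le_opNorm _).trans
      ((mul_le_mul (hbound m) hη'.le (norm_nonneg _) (norm_nonneg _)).trans hlt)
  have e2 : ‖x (ξ - σ n b Ω)‖ ≤ ε / 3 :=
    (x.le_opNorm _).trans ((mul_le_mul_of_nonneg_left hη'.le (norm_nonneg _)).trans hlt)
  have e3 := hN m hm
  rw [dist_eq_norm] at e3 ⊢
  have e4 : π m (a m) ξ - x ξ = π m (a m) (ξ - σ n b Ω) - x (ξ - σ n b Ω)
      + (π m (a m) (σ n b Ω) - x (σ n b Ω)) := by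
    simp only [map_sub]; abel
  rw [e4]
  linarith [norm_add_le (π m (a m) (ξ - σ n b Ω) - x (ξ - σ n b Ω))
    (π m (a m) (σ n b Ω) - x (σ n b Ω)),
    norm_sub_le (π m (a m) (ξ - σ n b Ω)) (x (ξ - σ n b Ω))]

end IsTracialPair
end TracialPair

/-! ### Strong closures and the ultraweak topology -/

section OperatorTopologies

variable {H : Type*} [NormedAddCommGroup H] [InnerProductSpace ℂ H]

/-- A bounded strongly convergent sequence converges ultraweakly. -/
theorem tendsto_ultraweakTopology {x : H →L[ℂ] H} {a : ℕ → H →L[ℂ] H} {C : ℝ}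
    (hC : ∀ n, ‖a n‖ ≤ C) (ha : ∀ ξ, Tendsto (fun n => a n ξ) atTop (𝓝 (x ξ))) :
    Tendsto a atTop (@nhds _ (ultraweakTopology H) x) := by
  rw [TopologicalSpace.tendsto_nhds_generateFrom_iff]
  rintro _ ⟨O, ξ, η, ε, hs, hε, rfl⟩ hx
  -- The subbasic set is centred at `O`, not at `x`, so the sum must converge to its value at `x`.
  -- The norm bound on the sequence supplies the dominating series.
  have key : Tendsto (fun n => ∑' i, ‖(inner ℂ (η i) ((a n - O) (ξ i)) : ℂ)‖) atTop
      (𝓝 (∑' i, ‖(inner ℂ (η i) ((x - O) (ξ i)) : ℂ)‖)) := by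
    refine tendsto_tsum_of_dominated_convergence
      (bound := fun i => (C + ‖O‖) * (‖ξ i‖ ^ 2 + ‖η i‖ ^ 2)) (hs.mul_left _) (fun i => ?_)
      (Eventually.of_forall fun n i => ?_)
    · exact (tendsto_const_nhds.inner ((ha (ξ i)).sub_const _)).norm
    · rw [norm_norm]
      have h1 : ‖a n - O‖ ≤ C + ‖O‖ := (norm_sub_le _ _).trans (by gcongr; exact hC n)
      have h2 : ‖η i‖ * ‖ξ i‖ ≤ ‖ξ i‖ ^ 2 + ‖η i‖ ^ 2 := by
        nlinarith [sq_nonneg (‖ξ i‖ - ‖η i‖), sq_nonneg ‖ξ i‖, sq_nonneg ‖η i‖]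
      calc ‖(inner ℂ (η i) ((a n - O) (ξ i)) : ℂ)‖
          ≤ ‖η i‖ * (‖a n - O‖ * ‖ξ i‖) := (norm_inner_le_norm _ _).trans
            (by gcongr; exact ContinuousLinearMap.le_opNorm _ _)
        _ = ‖a n - O‖ * (‖η i‖ * ‖ξ i‖) := by ring
        _ ≤ _ := mul_le_mul h1 h2 (by positivity) ((norm_nonneg _).trans h1)
  exact key.eventually_lt_const hx

theorem mem_strongClosure_of_tendsto {S : Set (H →L[ℂ] H)} {x : H →L[ℂ] H} {a : ℕ → H →L[ℂ] H}
    (haS : ∀ n, a n ∈ S) (ha : ∀ ξ, Tendsto (fun n => a n ξ) atTop (𝓝 (x ξ))) :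
    x ∈ strongClosure S := by
  let f : ℕ → H →Lₚₜ[ℂ] H := fun n =>
    ContinuousLinearMap.toPointwiseConvergenceCLM ℂ (RingHom.id ℂ) H H (a n)
  have hf : Tendsto f atTop
      (𝓝 (ContinuousLinearMap.toPointwiseConvergenceCLM ℂ (RingHom.id ℂ) H H x)) :=
    PointwiseConvergenceCLM.tendsto_iff_forall_tendsto.2 ha
  have hmem : ∀ n, f n ∈ ContinuousLinearMap.toPointwiseConvergenceCLM ℂ (RingHom.id ℂ) H H '' S :=
    fun n => ⟨a n, haS n, rfl⟩
  change ContinuousLinearMap.toPointwiseConvergenceCLM ℂ (RingHom.id ℂ) H H x ∈ closure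
    (ContinuousLinearMap.toPointwiseConvergenceCLM ℂ (RingHom.id ℂ) H H '' S)
  exact mem_closure_of_tendsto (X := H →Lₚₜ[ℂ] H) hf (Eventually.of_forall hmem)

/-- For fixed y and ξ, the condition y(zξ) = z(yξ) involves z only through its values at two
vectors, so it is strongly closed. -/
theorem strongClosure_subset_centralizer {S T : Set (H →L[ℂ] H)} (hST : S ⊆ Set.centralizer T) :
    strongClosure S ⊆ Set.centralizer T := by
  intro x hx y hy
  ext ξ
  have hcl : IsClosed {z : H →Lₚₜ[ℂ] H | y (z ξ) = z (y ξ)} :=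
    isClosed_eq (y.continuous.comp (PointwiseConvergenceCLM.evalCLM (RingHom.id ℂ) H ξ).continuous)
      (PointwiseConvergenceCLM.evalCLM (RingHom.id ℂ) H (y ξ)).continuous
  refine closure_minimal ?_ hcl hx
  rintro _ ⟨z, hz, rfl⟩
  exact congr($(hST hz y hy) ξ)

variable [CompleteSpace H]

theorem isNormal_vectorFunctional (M : VonNeumannAlgebra H) (Ω : H) :
    IsNormal (vectorFunctional M Ω) := by
  unfold IsNormal
  have h : @Continuous _ _ (ultraweakTopology H) _
      (fun x : H →L[ℂ] H => (inner ℂ Ω (x Ω) : ℂ)) := by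
    let _ := ultraweakTopology H
    rw [continuous_iff_continuousAt]
    intro O
    rw [ContinuousAt, Metric.tendsto_nhds]
    intro ε hε
    -- With both sequences equal to (Ω, 0, 0, …), the ultraweak seminorm is |⟨Ω, (P - O)Ω⟩|.
    let ξ : ℕ → H := fun i => if i = 0 then Ω else 0
    have hU : IsOpen {P : H →L[ℂ] H | ∑' i, ‖(inner ℂ (ξ i) ((P - O) (ξ i)) : ℂ)‖ < ε} := by
      refine TopologicalSpace.isOpen_generateFrom_of_mem ⟨O, ξ, ξ, ε, ?_, hε, rfl⟩
      refine summable_of_ne_finset_zero (s := {0}) fun i hi => ?_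
      simp only [Finset.mem_singleton] at hi
      simp [ξ, hi]
    filter_upwards [hU.mem_nhds (by simpa using hε)] with P hP
    change ∑' i, ‖(inner ℂ (ξ i) ((P - O) (ξ i)) : ℂ)‖ < ε at hP
    rw [tsum_eq_single 0 (fun i hi => by simp [ξ, hi])] at hP
    simpa [ξ, dist_eq_norm, inner_sub_right] using hP
  exact @Continuous.comp _ _ _ (_) (ultraweakTopology H) _ _ _ h (@continuous_induced_dom _ _ _ (_))

end OperatorTopologies

/-! ### The trace of a matrix algebra -/

/-- On matrix units: E_ij = E_ij E_jj while E_jj E_ij = 0 for i ≠ j, and E_kk = E_ki E_ik takes the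
same value as E_ii = E_ik E_ki. The form without division also covers an empty index set. -/
theorem Matrix.tracial_eq_smul_trace {m : Type*} [Fintype m] [DecidableEq m]
    (f : Matrix m m ℂ →ₗ[ℂ] ℂ) (hf : ∀ a b, f (a * b) = f (b * a)) (a : Matrix m m ℂ) :
    f 1 * a.trace = Fintype.card m * f a := by
  have hsingle : ∀ i j (c : ℂ), Fintype.card m * f (Matrix.single i j c)
      = f 1 * (Matrix.single i j c).trace := by
    intro i j c
    have hd : ∀ k, f (Matrix.single k k c) = f (Matrix.single i i c) := fun k => by
      have := hf (Matrix.single k i c) (Matrix.single i k 1)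
      simpa using this
    by_cases hij : i = j
    · subst hij
      have h1 : c • (1 : Matrix m m ℂ) = ∑ k, Matrix.single k k c := by
        ext p q
        simp [Matrix.sum_apply, Matrix.single_apply, Matrix.one_apply]
        by_cases h : p = q
        · subst h; simp
        · simp [h]
          rw [Finset.sum_eq_zero]
          intro k _
          rw [if_neg]
          rintro ⟨rfl, rfl⟩
          exact h rfl
      have h2 := congr(f $h1)
      simp only [map_smul, map_sum, hd, Finset.sum_const, Finset.card_univ, nsmul_eq_mul,
        smul_eq_mul] at h2
      rw [← h2, Matrix.trace_single_eq_same, mul_comm]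
    · have h1 := hf (Matrix.single i j c) (Matrix.single j j 1)
      rw [Matrix.single_mul_single_same, Matrix.single_mul_single_of_ne _ _ _ _ (Ne.symm hij),
        map_zero, mul_one] at h1
      rw [h1, Matrix.trace_single_eq_of_ne _ _ _ hij, mul_zero, mul_zero]
  rw [Matrix.matrix_eq_sum_single a]
  simp only [map_sum, Matrix.trace_sum, Finset.mul_sum, hsingle]

/-! ### The von Neumann algebras generated by a tracial pair -/

section TracialPair

variable {H : Type*} [NormedAddCommGroup H] [InnerProductSpace ℂ H] [CompleteSpace H]
  {ι : ℕ → Type*} [∀ n, Fintype (ι n)] [∀ n, DecidableEq (ι n)]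

theorem star_localAlgebra (π : ∀ n, Matrix (ι n) (ι n) ℂ →⋆ₐ[ℂ] (H →L[ℂ] H)) :
    star (localAlgebra π) = localAlgebra π := by
  ext x
  simp only [Set.mem_star, localAlgebra, Set.mem_iUnion, Set.mem_range]
  constructor
  · rintro ⟨n, a, ha⟩; exact ⟨n, star a, by rw [map_star, ha, star_star]⟩
  · rintro ⟨n, a, rfl⟩; exact ⟨n, star a, by rw [map_star]⟩

/-- The commutant of the union of the ranges of `σ n`. -/
noncomputable def commutantAlgebra (σ : ∀ n, Matrix (ι n) (ι n) ℂ →⋆ₐ[ℂ] (H →L[ℂ] H)) :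
    VonNeumannAlgebra H where
  toStarSubalgebra := StarSubalgebra.centralizer ℂ (localAlgebra σ)
  centralizer_centralizer' := by simp

theorem coe_commutantAlgebra (σ : ∀ n, Matrix (ι n) (ι n) ℂ →⋆ₐ[ℂ] (H →L[ℂ] H)) :
    (commutantAlgebra σ : Set (H →L[ℂ] H)) = Set.centralizer (localAlgebra σ) := by
  change (StarSubalgebra.centralizer ℂ (localAlgebra σ) : Set (H →L[ℂ] H)) = _
  rw [StarSubalgebra.coe_centralizer, star_localAlgebra, Set.union_self]

theorem mem_commutantAlgebra {σ : ∀ n, Matrix (ι n) (ι n) ℂ →⋆ₐ[ℂ] (H →L[ℂ] H)} {x : H →L[ℂ] H} :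
    x ∈ commutantAlgebra σ ↔ ∀ n b, Commute (σ n b) x := by
  rw [← SetLike.mem_coe, coe_commutantAlgebra]
  simp only [localAlgebra, Set.mem_centralizer_iff, commute_iff_eq, Set.mem_iUnion, Set.mem_range]
  exact ⟨fun h n b => h _ ⟨n, b, rfl⟩, by rintro h _ ⟨n, b, rfl⟩; exact h n b⟩

namespace IsTracialPair

variable {Ω : H} {π σ : ∀ n, Matrix (ι n) (ι n) ℂ →⋆ₐ[ℂ] (H →L[ℂ] H)}

theorem mem_algebra (h : IsTracialPair Ω π σ) (n a) : π n a ∈ commutantAlgebra σ :=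
  mem_commutantAlgebra.2 fun m b => (h.commute_of_ne n m a b).symm

/-- One inclusion is the approximation by sequences in `exists_approx`; the other holds because a
commutant is strongly closed. -/
theorem coe_algebra (h : IsTracialPair Ω π σ) :
    (commutantAlgebra σ : Set (H →L[ℂ] H)) = strongClosure (localAlgebra π) := by
  refine Set.Subset.antisymm (fun x hx => ?_) ?_
  · obtain ⟨a, -, ha⟩ := h.exists_approx (mem_commutantAlgebra.1 hx)
    exact mem_strongClosure_of_tendsto
      (fun n => Set.mem_iUnion.2 ⟨n, Set.mem_range_self (a n)⟩) ha
  · rw [coe_commutantAlgebra]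
    refine strongClosure_subset_centralizer ?_
    rw [← coe_commutantAlgebra]
    intro x hx
    obtain ⟨n, a, rfl⟩ := Set.mem_iUnion.1 hx
    exact h.mem_algebra n a

theorem commutant_algebra (h : IsTracialPair Ω π σ) :
    (commutantAlgebra σ).commutant = commutantAlgebra π := by
  ext y
  rw [VonNeumannAlgebra.mem_commutant_iff, mem_commutantAlgebra]
  refine ⟨fun hy n a => hy _ (h.mem_algebra n a), fun hy x hx => ?_⟩
  obtain ⟨a, -, ha⟩ := h.exists_approx (mem_commutantAlgebra.1 hx)
  ext ξ
  refine tendsto_nhds_unique (ha (y ξ)) (((y.continuous.tendsto _).comp (ha ξ)).congr fun n => ?_)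
  exact congr($((hy n (a n)).eq.symm) ξ)

/-- Multiplication is strongly continuous in each factor separately, so the trace identity is
extended one factor at a time: `key` replaces the first matrix by `x`, and a second limit replaces
the other by `y`. -/
theorem inner_mul_comm (h : IsTracialPair Ω π σ) {x y : H →L[ℂ] H}
    (hx : x ∈ commutantAlgebra σ) (hy : y ∈ commutantAlgebra σ) :
    (inner ℂ Ω (x (y Ω)) : ℂ) = inner ℂ Ω (y (x Ω)) := by
  have key : ∀ {x : H →L[ℂ] H}, x ∈ commutantAlgebra σ → ∀ n c,
      (inner ℂ Ω (x (π n c Ω)) : ℂ) = inner ℂ Ω (π n c (x Ω)) := by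
    intro x hx n c
    obtain ⟨a, -, ha⟩ := h.exists_approx (mem_commutantAlgebra.1 hx)
    refine tendsto_nhds_unique (tendsto_const_nhds.inner (ha (π n c Ω)))
      ((tendsto_const_nhds.inner (((π n c).continuous.tendsto _).comp (ha Ω))).congr fun m => ?_)
    -- Both operators are moved into one matrix algebra, where the vector state is a multiple of the
    -- matrix trace.
    obtain ⟨c', hc⟩ := h.exists_le_left (le_max_left n m) c
    obtain ⟨a', ha'⟩ := h.exists_le_left (le_max_right n m) (a m)
    obtain ⟨k, hk⟩ := h.trace_left (max n m)
    simp only [Function.comp_apply]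
    rw [← hc, ← ha', ← mul_apply_eq_comp, ← mul_apply_eq_comp, ← map_mul, ← map_mul, hk, hk,
      Matrix.trace_mul_comm]
  obtain ⟨a, -, ha⟩ := h.exists_approx (mem_commutantAlgebra.1 hy)
  refine tendsto_nhds_unique (tendsto_const_nhds.inner ((x.continuous.tendsto _).comp (ha Ω)))
    ((tendsto_const_nhds.inner (ha (x Ω))).congr fun n => ?_)
  exact (key hx n (a n)).symm

/-- A tracial functional on the algebra is a multiple of the vector state on each of the matrix
algebras. -/
theorem apply_eq_of_tracial (h : IsTracialPair Ω π σ) (n : ℕ) (f : Matrix (ι n) (ι n) ℂ →ₗ[ℂ] ℂ)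
    (hf : ∀ a b, f (a * b) = f (b * a)) (a) : f a = f 1 * inner ℂ Ω (π n a Ω) := by
  obtain ⟨k, hk⟩ := h.trace_left n
  -- At the identity this reads 1 = k · card, so the cardinality is non-zero and k is its inverse.
  have h1 := hk 1
  rw [map_one, one_apply_eq_self, h.inner_self, Matrix.trace_one] at h1
  have hc : (Fintype.card (ι n) : ℂ) ≠ 0 := by
    intro h0
    simp [h0] at h1
  have h2 := Matrix.tracial_eq_smul_trace f hf a
  refine mul_left_cancel₀ hc ?_
  rw [← h2, hk]
  linear_combination f 1 * a.trace * h1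

/-- Faithfulness: ⟨Ω, x*xΩ⟩ = ‖xΩ‖², and Ω is separating. Uniqueness: a normal trace is fixed on
every matrix algebra, and the bounded approximants of x converge to it ultraweakly. -/
theorem isUniqueNormalTrace (h : IsTracialPair Ω π σ) :
    IsUniqueNormalTrace (vectorFunctional (commutantAlgebra σ) Ω) := by
  refine ⟨fun x => ⟨?_, ?_⟩, ?_, fun x hx => ?_, isNormal_vectorFunctional _ _, fun x y => ?_,
    fun τ hn ht h1 => ?_⟩
  · change (0 : ℂ) ≤ inner ℂ Ω ((star (x : H →L[ℂ] H)) ((x : H →L[ℂ] H) Ω))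
    rw [ContinuousLinearMap.star_eq_adjoint, ContinuousLinearMap.adjoint_inner_right,
      inner_self_eq_norm_sq_to_K]
    exact (Complex.zero_le_real.2 (sq_nonneg ‖(x : H →L[ℂ] H) Ω‖)).trans_eq (by simp)
  · change (inner ℂ Ω ((star (x : H →L[ℂ] H)) Ω) : ℂ) = star (inner ℂ Ω ((x : H →L[ℂ] H) Ω))
    rw [ContinuousLinearMap.star_eq_adjoint, ContinuousLinearMap.adjoint_inner_right]
    exact (inner_conj_symm _ _).symm
  · exact h.inner_self
  · change (inner ℂ Ω ((star (x : H →L[ℂ] H)) ((x : H →L[ℂ] H) Ω)) : ℂ) = 0 at hx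
    rw [ContinuousLinearMap.star_eq_adjoint, ContinuousLinearMap.adjoint_inner_right,
      inner_self_eq_zero] at hx
    refine Subtype.ext (h.ext_of_commutant (mem_commutantAlgebra.1 x.2) (fun n b => ?_) ?_)
    · exact Commute.zero_right _
    · exact hx
  · exact h.inner_mul_comm x.2 y.2
  · have hloc : ∀ n a, τ ⟨π n a, h.mem_algebra n a⟩ = inner ℂ Ω (π n a Ω) := by
      intro n a
      let g : Matrix (ι n) (ι n) ℂ →⋆ₐ[ℂ] (commutantAlgebra σ).toStarSubalgebra :=
        (π n).codRestrict _ (h.mem_algebra n)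
      have h2 := h.apply_eq_of_tracial n (τ ∘ₗ (g : Matrix (ι n) (ι n) ℂ →ₐ[ℂ]
        (commutantAlgebra σ).toStarSubalgebra).toLinearMap)
        (fun a b => by simpa using ht (g a) (g b)) a
      have h3 : τ (g 1) = 1 := by rw [map_one, h1]
      change τ (g a) = τ (g 1) * _ at h2
      rw [h3, one_mul] at h2
      exact h2
    ext x
    obtain ⟨a, hC, ha⟩ := h.exists_approx (mem_commutantAlgebra.1 x.2)
    -- This overrides the norm topology, so that the limits below are ultraweak.
    let _ : TopologicalSpace (commutantAlgebra σ).toStarSubalgebra :=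
      (ultraweakTopology H).induced Subtype.val
    have ht : Tendsto (fun n => (⟨π n (a n), h.mem_algebra n (a n)⟩ :
        (commutantAlgebra σ).toStarSubalgebra)) atTop (𝓝 x) := by
      rw [@nhds_induced _ _ (ultraweakTopology H) Subtype.val x, tendsto_comap_iff]
      exact tendsto_ultraweakTopology hC ha
    have hn' : Continuous τ := hn
    refine tendsto_nhds_unique ((hn'.tendsto x).comp ht)
      ((tendsto_const_nhds.inner (ha Ω)).congr fun n => ?_)
    exact (hloc n (a n)).symm

theorem isFactor (h : IsTracialPair Ω π σ) : IsFactor (commutantAlgebra σ) := by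
  rw [IsFactor, h.commutant_algebra]
  ext x
  refine ⟨fun ⟨hx, hx'⟩ => ?_, ?_⟩
  · rw [SetLike.mem_coe] at hx hx'
    set c : ℂ := inner ℂ Ω (x Ω)
    refine ⟨c, h.ext_of_commutant (mem_commutantAlgebra.1 hx)
      (fun n b => (Commute.one_right _).smul_right c) ?_⟩
    -- The functional a ↦ ⟨Ω, xaΩ⟩ is tracial because x lies in the algebra and commutes with it.
    -- Evaluated at a*, it computes ⟨aΩ, xΩ⟩.
    have key : ∀ n a, (inner ℂ (π n a Ω) (x Ω) : ℂ) = inner ℂ (π n a Ω) (c • Ω) := by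
      intro n a
      let f : Matrix (ι n) (ι n) ℂ →ₗ[ℂ] ℂ :=
        { toFun := fun a => inner ℂ Ω (x (π n a Ω))
          map_add' := fun a b => by simp
          map_smul' := fun c a => by simp }
      have hf : ∀ a b, f (a * b) = f (b * a) := by
        intro a b
        change (inner ℂ Ω (x (π n (a * b) Ω)) : ℂ) = inner ℂ Ω (x (π n (b * a) Ω))
        have h1 := h.inner_mul_comm (mul_mem hx (h.mem_algebra n a)) (h.mem_algebra n b)
        have h2 := congr($((mem_commutantAlgebra.1 hx' n b).eq) (π n a Ω))
        simp only [mul_apply_eq_comp, map_mul] at h1 h2 ⊢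
        rw [h1, h2]
      have h1 := h.apply_eq_of_tracial n f hf (star a)
      have h2 : f 1 = c := by simp [f, c]
      have h3 : f (star a) = inner ℂ Ω (π n (star a) (x Ω)) := by
        have := congr($((mem_commutantAlgebra.1 hx' n (star a)).eq) Ω)
        exact congr(inner ℂ Ω $this.symm)
      rw [h2, h3, map_star, ContinuousLinearMap.star_eq_adjoint,
        ContinuousLinearMap.adjoint_inner_right, ContinuousLinearMap.adjoint_inner_right] at h1
      rw [h1, inner_smul_right]
    change x Ω = c • Ω
    refine h.dense.eq_of_inner_right (𝕜 := ℂ) ?_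
    rintro _ ⟨n, a, rfl⟩
    exact key n a
  · rintro ⟨c, rfl⟩
    exact ⟨(mem_commutantAlgebra.2 fun n b => (Commute.one_right _).smul_right c),
      (mem_commutantAlgebra.2 fun n b => (Commute.one_right _).smul_right c)⟩

theorem not_finiteDimensional (h : IsTracialPair Ω π σ) :
    ¬ FiniteDimensional ℂ (commutantAlgebra σ).toStarSubalgebra := by
  intro hfin
  obtain ⟨n, hn⟩ := h.exists_lt_card
    (Module.finrank ℂ (commutantAlgebra σ).toStarSubalgebra)
  let g : Matrix (ι n) (ι n) ℂ →⋆ₐ[ℂ] (commutantAlgebra σ).toStarSubalgebra :=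
    (π n).codRestrict _ (h.mem_algebra n)
  have hg : Function.Injective (g : Matrix (ι n) (ι n) ℂ →ₐ[ℂ]
        (commutantAlgebra σ).toStarSubalgebra).toLinearMap := by
    rw [injective_iff_map_eq_zero]
    intro a ha
    exact h.injective n congr(($ha : H →L[ℂ] H) Ω)
  have := LinearMap.finrank_le_finrank_of_injective hg
  rw [Module.finrank_matrix, Module.finrank_self, mul_one] at this
  -- The square of the matrix size is at most the dimension, which was chosen smaller than the size
  -- itself.
  nlinarith

theorem isTypeII1Factor (h : IsTracialPair Ω π σ) : IsTypeII1Factor (commutantAlgebra σ) := by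
  obtain ⟨hp, h1, -, hn, ht, -⟩ := h.isUniqueNormalTrace
  refine ⟨h.isFactor, h.not_finiteDimensional, _, ?_, ht, fun x => (hp x).1, hn⟩
  intro h0
  rw [h0] at h1
  exact zero_ne_one h1

/-- An x in the double commutant commutes with the projection onto the local space, so xΩ = aΩ for
some a at level n. It also commutes with all of σ, so x = a because Ω is separating. -/
theorem centralizer_centralizer_range (h : IsTracialPair Ω π σ) (n : ℕ) :
    Set.centralizer (Set.centralizer (Set.range (π n))) = Set.range (π n) := by
  refine Set.Subset.antisymm (fun x hx => ?_) Set.subset_centralizer_centralizer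
  have hV : (localSpace Ω π n).starProjection ∈ Set.centralizer (Set.range (π n)) := by
    rintro _ ⟨a, rfl⟩
    exact commute_starProjection n a
  have hσ : ∀ m b, Commute (σ m b) x := fun m b => hx _ (by
    rintro _ ⟨a, rfl⟩
    exact h.commute_of_ne n m a b)
  have hΩ : Ω ∈ localSpace Ω π n := ⟨1, by simp⟩
  have h1 := congr($(hx _ hV) Ω)
  simp only [mul_apply_eq_comp] at h1
  rw [Submodule.starProjection_eq_self_iff.2 hΩ, Submodule.starProjection_eq_self_iff] at h1
  obtain ⟨a, ha⟩ := mem_localSpace.1 h1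
  exact ⟨a, h.ext_of_commutant (fun m b => (h.commute_of_ne n m a b).symm) hσ ha⟩

theorem isHyperfinite (h : IsTracialPair Ω π σ) : IsHyperfinite (commutantAlgebra σ) := by
  let A : ℕ → VonNeumannAlgebra H := fun n =>
    { (π n).range with
      centralizer_centralizer' := h.centralizer_centralizer_range n }
  have hA : ∀ n x, x ∈ A n ↔ ∃ a, π n a = x := fun n x => Iff.rfl
  refine ⟨A, fun n => ?_, fun n x hx => ?_, fun n x hx => ?_, ?_⟩
  · change FiniteDimensional ℂ
      (LinearMap.range ((π n : Matrix (ι n) (ι n) ℂ →ₐ[ℂ] (H →L[ℂ] H)).toLinearMap))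
    infer_instance
  · obtain ⟨a, rfl⟩ := (hA n x).1 hx
    exact (hA _ _).2 (h.exists_succ_left n a)
  · obtain ⟨a, rfl⟩ := (hA n x).1 hx
    exact h.mem_algebra n a
  · have hU : (⋃ n, (A n : Set (H →L[ℂ] H))) = localAlgebra π := rfl
    rw [hU, ← coe_commutantAlgebra, ← VonNeumannAlgebra.coe_commutant, h.symm.commutant_algebra]

end IsTracialPair

/-- The strong closures of the two algebras of a tracial pair are hyperfinite type II₁ factors,
they are the commutants of each other, and `Ω` implements the unique normal trace on both. -/
theorem IsTracialPair.exists_algebra {Ω : H} {π σ : ∀ n, Matrix (ι n) (ι n) ℂ →⋆ₐ[ℂ] (H →L[ℂ] H)}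
    (h : IsTracialPair Ω π σ) :
    ∃ M : VonNeumannAlgebra H,
      (M : Set (H →L[ℂ] H)) = strongClosure (localAlgebra π) ∧
      (M.commutant : Set (H →L[ℂ] H)) = strongClosure (localAlgebra σ) ∧
      IsFactor M ∧ IsFactor M.commutant ∧
      IsUniqueNormalTrace (vectorFunctional M Ω) ∧
      IsUniqueNormalTrace (vectorFunctional M.commutant Ω) ∧
      (IsTypeII1Factor M ∧ IsHyperfinite M) ∧
      (IsTypeII1Factor M.commutant ∧ IsHyperfinite M.commutant) := by
  refine ⟨commutantAlgebra σ, h.coe_algebra, ?_⟩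
  rw [h.commutant_algebra]
  exact ⟨h.symm.coe_algebra, h.isFactor, h.symm.isFactor, h.isUniqueNormalTrace,
    h.symm.isUniqueNormalTrace, ⟨h.isTypeII1Factor, h.isHyperfinite⟩,
    h.symm.isTypeII1Factor, h.symm.isHyperfinite⟩

end TracialPair

/-! ### Operators on finitely many collections form a representation -/

section Collections

variable {κ : Type} [Fintype κ]

omit [Fintype κ] in
theorem overwrite_overwrite {N n : ℕ} (q r : Fin N → κ) (t : Fin n → κ) :
    overwrite r (overwrite q t) = overwrite r t := by
  ext k
  by_cases hk : (k : ℕ) < N <;> simp [overwrite, hk]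

omit [Fintype κ] in
theorem overwrite_castLE {N n : ℕ} (h : N ≤ n) (q : Fin N → κ) (t : Fin n → κ) :
    (fun k => overwrite q t (Fin.castLE h k)) = q := by
  ext k
  simp [overwrite]

omit [Fintype κ] in
theorem overwrite_self {N n : ℕ} (h : N ≤ n) (t : Fin n → κ) :
    overwrite (fun k => t (Fin.castLE h k)) t = t := by
  ext k
  simp [overwrite]

omit [Fintype κ] in
theorem overwrite_eq_left {N : ℕ} (q t : Fin N → κ) : overwrite q t = q := by
  ext k
  simp [overwrite]

theorem finOp_add {N n : ℕ} (A B : Matrix (Fin N → κ) (Fin N → κ) ℂ) :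
    finOp (A + B) n = finOp A n + finOp B n := by
  by_cases h : N ≤ n
  · ext ψ t
    simp [finOp_apply _ h, add_mul, Finset.sum_add_distrib]
  · simp [finOp, h]

theorem finOp_smul {N n : ℕ} (c : ℂ) (A : Matrix (Fin N → κ) (Fin N → κ) ℂ) :
    finOp (c • A) n = c • finOp A n := by
  by_cases h : N ≤ n
  · ext ψ t
    simp [finOp_apply _ h, mul_assoc, Finset.mul_sum]
  · simp [finOp, h]

theorem finOp_mul {N n : ℕ} (h : N ≤ n) (A B : Matrix (Fin N → κ) (Fin N → κ) ℂ)
    (ψ : FinSpace κ n) : finOp (A * B) n ψ = finOp A n (finOp B n ψ) := by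
  ext t
  simp only [finOp_apply _ h, overwrite_overwrite, overwrite_castLE, Matrix.mul_apply,
    Finset.sum_mul, Finset.mul_sum, mul_assoc]
  exact Finset.sum_comm

theorem finOp_one [DecidableEq κ] {N n : ℕ} (h : N ≤ n) (ψ : FinSpace κ n) :
    finOp (1 : Matrix (Fin N → κ) (Fin N → κ) ℂ) n ψ = ψ := by
  ext t
  simp [finOp_apply _ h, Matrix.one_apply, overwrite_self]

theorem inner_finOp_conjTranspose {N n : ℕ} (h : N ≤ n) (A : Matrix (Fin N → κ) (Fin N → κ) ℂ)
    (ψ φ : FinSpace κ n) :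
    (inner ℂ (finOp A.conjTranspose n ψ) φ : ℂ) = inner ℂ ψ (finOp A n φ) := by
  -- Swapping the first `N` entries of the outer index with the summation index exchanges rows and
  -- columns of `A`, matching the two double sums term by term.
  let e : (Fin n → κ) × (Fin N → κ) → (Fin n → κ) × (Fin N → κ) :=
    fun x => (overwrite x.2 x.1, fun k => x.1 (Fin.castLE h k))
  have he : Function.Involutive e := by
    rintro ⟨t, q⟩
    simp [e, overwrite_overwrite, overwrite_castLE, overwrite_self]
  simp only [PiLp.inner_apply, RCLike.inner_apply, finOp_apply _ h, map_sum, Finset.mul_sum,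
    Finset.sum_mul]
  rw [← Fintype.sum_prod_type', ← Fintype.sum_prod_type', ← Equiv.sum_comp (he.toPerm e)]
  refine Finset.sum_congr rfl fun x _ => ?_
  simp only [Function.Involutive.coe_toPerm, e, overwrite_overwrite, overwrite_castLE,
    overwrite_self, map_mul, Matrix.conjTranspose_apply, RCLike.star_def, RCLike.conj_conj]
  ring

/-- The matrix of `A ⊗ I`, with one more collection. -/
def extendMatrix [DecidableEq κ] {N : ℕ} (A : Matrix (Fin N → κ) (Fin N → κ) ℂ) :
    Matrix (Fin (N + 1) → κ) (Fin (N + 1) → κ) ℂ :=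
  fun s t => if s (Fin.last N) = t (Fin.last N) then A (Fin.init s) (Fin.init t) else 0

theorem finOp_extendMatrix [DecidableEq κ] {N n : ℕ} (h : N + 1 ≤ n)
    (A : Matrix (Fin N → κ) (Fin N → κ) ℂ) (ψ : FinSpace κ n) :
    finOp (extendMatrix A) n ψ = finOp A n ψ := by
  ext t
  rw [finOp_apply _ h, finOp_apply _ (N.le_succ.trans h),
    ← (Fin.snocEquiv (fun _ : Fin (N + 1) => κ)).sum_comp, Fintype.sum_prod_type, Finset.sum_comm]
  refine Finset.sum_congr rfl fun q _ => ?_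
  simp only [extendMatrix, Fin.snocEquiv, Equiv.coe_fn_mk, Fin.snoc_last, Fin.init_snoc, ite_mul,
    zero_mul, Finset.sum_ite_eq, Finset.mem_univ, if_true]
  -- The added identity factor leaves only the term in which entry `N` is overwritten by itself.
  have h1 : overwrite (Fin.snoc q (t (Fin.castLE h (Fin.last N))) : Fin (N + 1) → κ) t
      = overwrite q t := by
    ext k
    rcases lt_trichotomy (k : ℕ) N with hk | hk | hk
    · simp [overwrite, hk, Fin.snoc, hk.trans N.lt_succ_self]
    · simp only [overwrite, hk, Fin.snoc, lt_irrefl, N.lt_succ_self, dif_pos, dif_neg,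
        not_false_eq_true]
      simp only [cast_eq]
      congr 1
      exact Fin.ext hk.symm
    · simp [overwrite, hk.not_gt, (Nat.succ_le_of_lt hk).not_gt]
  rw [h1]
  rfl

variable {ref : Metric.sphere (0 : EuclideanSpace ℂ κ) 1}

/-- The difference is a null vector of the seminorm, and the completion is separated. -/
theorem PreSpace.coe_eq_coe {f g : PreSpace ref}
    (h : ∀ᶠ n in atTop, PreSpace.comp n f = PreSpace.comp n g) :
    (f : ChainSpace ref) = (g : ChainSpace ref) := by
  rw [← sub_eq_zero, ← UniformSpace.Completion.coe_sub, ← norm_eq_zero,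
    UniformSpace.Completion.norm_coe]
  obtain ⟨n, h1, h2⟩ := ((f - g).eventually_norm.and h).exists
  rw [← h1, map_sub, h2, sub_self, norm_zero]

theorem PreSpace.coe_eq_coe_of_comp_eq {f g : PreSpace ref} {N : ℕ}
    (hf : ∀ n ≥ N, PreSpace.comp (n + 1) f = appendRef (ref : EuclideanSpace ℂ κ) n
      (PreSpace.comp n f))
    (hg : ∀ n ≥ N, PreSpace.comp (n + 1) g = appendRef (ref : EuclideanSpace ℂ κ) n
      (PreSpace.comp n g))
    (h : PreSpace.comp N f = PreSpace.comp N g) : (f : ChainSpace ref) = (g : ChainSpace ref) := by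
  refine PreSpace.coe_eq_coe ((eventually_ge_atTop N).mono fun n hn => ?_)
  induction n, hn using Nat.le_induction with
  | base => exact h
  | succ k hk ih => rw [hf k hk, hg k hk, ih]

theorem PreSpace.inner_eq_inner_comp {f g : PreSpace ref} {N : ℕ}
    (hf : ∀ n ≥ N, PreSpace.comp (n + 1) f = appendRef (ref : EuclideanSpace ℂ κ) n
      (PreSpace.comp n f))
    (hg : ∀ n ≥ N, PreSpace.comp (n + 1) g = appendRef (ref : EuclideanSpace ℂ κ) n
      (PreSpace.comp n g)) :
    (inner ℂ f g : ℂ) = inner ℂ (PreSpace.comp N f) (PreSpace.comp N g) := by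
  have hc : ∀ n ≥ N, (inner ℂ (PreSpace.comp n f) (PreSpace.comp n g) : ℂ)
      = inner ℂ (PreSpace.comp N f) (PreSpace.comp N g) := by
    intro n hn
    induction n, hn using Nat.le_induction with
    | base => rfl
    | succ k hk ih => rw [hf k hk, hg k hk, inner_appendRef, ih]
  obtain ⟨n, h1, h2⟩ := ((eventually_preInner f g).and (eventually_ge_atTop N)).exists
  rw [← hc n h2, h1]
  rfl

theorem comp_preOp {N : ℕ} (A : Matrix (Fin N → κ) (Fin N → κ) ℂ) (f : PreSpace ref) (n : ℕ) :
    PreSpace.comp n (preOp A f) = finOp A n (PreSpace.comp n f) := rfl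

theorem localOp_coe {N : ℕ} (A : Matrix (Fin N → κ) (Fin N → κ) ℂ) (f : PreSpace ref) :
    localOp ref A f = (preOp A f : PreSpace ref) :=
  ContinuousLinearMap.completion_apply_coe _ _

theorem ChainSpace.operator_ext {x y : ChainSpace ref →L[ℂ] ChainSpace ref}
    (h : ∀ f : PreSpace ref, x f = y f) : x = y := by
  ext ξ
  induction ξ using UniformSpace.Completion.induction_on with
  | hp => exact isClosed_eq x.continuous y.continuous
  | ih f => exact h f

theorem localOp_adjoint {N : ℕ} (A : Matrix (Fin N → κ) (Fin N → κ) ℂ) :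
    localOp ref A.conjTranspose = ContinuousLinearMap.adjoint (localOp ref A) := by
  rw [ContinuousLinearMap.eq_adjoint_iff]
  intro ξ η
  induction ξ, η using UniformSpace.Completion.induction_on₂ with
  | hp => exact isClosed_eq (by fun_prop) (by fun_prop)
  | ih f g =>
    rw [localOp_coe, localOp_coe, UniformSpace.Completion.inner_coe,
      UniformSpace.Completion.inner_coe]
    obtain ⟨n, h1, h2, h3⟩ := ((eventually_preInner (preOp A.conjTranspose f) g).and
      ((eventually_preInner f (preOp A g)).and (eventually_ge_atTop N))).exists
    change preInner _ _ = preInner _ _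
    rw [← h1, ← h2, comp_preOp, comp_preOp, inner_finOp_conjTranspose h3]

variable (ref) in
/-- The operators on the first `N` collections, as a representation of a matrix algebra. -/
noncomputable def localHom [DecidableEq κ] (N : ℕ) :
    Matrix (Fin N → κ) (Fin N → κ) ℂ →⋆ₐ[ℂ] (ChainSpace ref →L[ℂ] ChainSpace ref) :=
  have hsmul : ∀ (c : ℂ) (A : Matrix (Fin N → κ) (Fin N → κ) ℂ),
      localOp ref (c • A) = c • localOp ref A := fun c A => ChainSpace.operator_ext fun f => by
    rw [smul_apply, localOp_coe, localOp_coe,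
      ← UniformSpace.Completion.coe_smul]
    refine PreSpace.coe_eq_coe (Eventually.of_forall fun n => ?_)
    rw [map_smul, comp_preOp, comp_preOp, finOp_smul, LinearMap.smul_apply]
  have hone : localOp ref (1 : Matrix (Fin N → κ) (Fin N → κ) ℂ) = 1 :=
    ChainSpace.operator_ext fun f => by
      rw [one_apply_eq_self, localOp_coe]
      -- Below level `N` the operator `finOp` is 0 by default, so the identity holds only
      -- eventually; this suffices in the completion.
      refine PreSpace.coe_eq_coe ((eventually_ge_atTop N).mono fun n hn => ?_)
      rw [comp_preOp, finOp_one hn]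
  { toFun := localOp ref
    map_one' := hone
    map_mul' := fun A B => ChainSpace.operator_ext fun f => by
      rw [mul_apply_eq_comp, localOp_coe, localOp_coe, localOp_coe]
      refine PreSpace.coe_eq_coe ((eventually_ge_atTop N).mono fun n hn => ?_)
      rw [comp_preOp, comp_preOp, comp_preOp, finOp_mul hn]
    map_zero' := by simpa using hsmul 0 0
    map_add' := fun A B => ChainSpace.operator_ext fun f => by
      rw [add_apply, localOp_coe, localOp_coe, localOp_coe,
        ← UniformSpace.Completion.coe_add]
      refine PreSpace.coe_eq_coe (Eventually.of_forall fun n => ?_)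
      rw [map_add, comp_preOp, comp_preOp, comp_preOp, finOp_add, LinearMap.add_apply]
    commutes' := fun c => by
      rw [Algebra.algebraMap_eq_smul_one, Algebra.algebraMap_eq_smul_one, hsmul, hone]
    map_star' := fun A => localOp_adjoint A }

theorem localOp_extendMatrix [DecidableEq κ] {N : ℕ} (A : Matrix (Fin N → κ) (Fin N → κ) ℂ) :
    localOp ref (extendMatrix A) = localOp ref A :=
  ChainSpace.operator_ext fun f => by
    rw [localOp_coe, localOp_coe]
    refine PreSpace.coe_eq_coe ((eventually_ge_atTop (N + 1)).mono fun n hn => ?_)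
    rw [comp_preOp, comp_preOp, finOp_extendMatrix hn]

theorem comp_preRefVector (n : ℕ) :
    PreSpace.comp (n + 1) (preRefVector ref) =
      appendRef (ref : EuclideanSpace ℂ κ) n (PreSpace.comp n (preRefVector ref)) := by
  ext t
  exact Fin.prod_univ_castSucc fun k => (ref : EuclideanSpace ℂ κ) (t k)

theorem comp_preOp_preRefVector {N : ℕ} (A : Matrix (Fin N → κ) (Fin N → κ) ℂ) (n : ℕ)
    (hn : N ≤ n) :
    PreSpace.comp (n + 1) (preOp A (preRefVector ref)) =
      appendRef (ref : EuclideanSpace ℂ κ) n (PreSpace.comp n (preOp A (preRefVector ref))) := by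
  rw [comp_preOp, comp_preOp, ← finOp_appendRef _ A hn, comp_preRefVector]

end Collections

/-! ### Rows of maximally entangled pairs -/

section Rows

variable {K : Type} [Fintype K] [DecidableEq K]

omit [Fintype K] in
-- In Kronecker form, the *-algebra laws and the commutation of the two rows follow from the
-- Kronecker calculus.
theorem topMatrix_eq {N : ℕ} (a : Matrix (Fin N → K) (Fin N → K) ℂ) :
    topMatrix a = (Matrix.kroneckerMap (· * ·) a (1 : Matrix (Fin N → K) (Fin N → K) ℂ)).submatrix
      (Equiv.arrowProdEquivProdArrow (Fin N) (fun _ => K) (fun _ => K))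
      (Equiv.arrowProdEquivProdArrow (Fin N) (fun _ => K) (fun _ => K)) := by
  ext s t
  simp [topMatrix, Matrix.one_apply, funext_iff, Equiv.arrowProdEquivProdArrow]

omit [Fintype K] in
theorem bottomMatrix_eq {N : ℕ} (a : Matrix (Fin N → K) (Fin N → K) ℂ) :
    bottomMatrix a =
      (Matrix.kroneckerMap (· * ·) (1 : Matrix (Fin N → K) (Fin N → K) ℂ) a).submatrix
      (Equiv.arrowProdEquivProdArrow (Fin N) (fun _ => K) (fun _ => K))
      (Equiv.arrowProdEquivProdArrow (Fin N) (fun _ => K) (fun _ => K)) := by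
  ext s t
  simp [bottomMatrix, Matrix.one_apply, funext_iff, Equiv.arrowProdEquivProdArrow]

/-- `topMatrix` as a homomorphism of *-algebras. -/
def topHom (N : ℕ) : Matrix (Fin N → K) (Fin N → K) ℂ →⋆ₐ[ℂ]
    Matrix (Fin N → K × K) (Fin N → K × K) ℂ where
  toFun := topMatrix
  map_one' := by simp [topMatrix_eq]
  map_mul' a b := by
    rw [topMatrix_eq, topMatrix_eq, topMatrix_eq, Matrix.submatrix_mul_equiv,
      ← Matrix.mul_kronecker_mul, one_mul]
  map_zero' := by ext; simp [topMatrix]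
  map_add' a b := by ext; simp [topMatrix]; split_ifs <;> simp
  commutes' c := by
    rw [Algebra.algebraMap_eq_smul_one, Algebra.algebraMap_eq_smul_one, topMatrix_eq,
      Matrix.smul_kronecker, Matrix.one_kronecker_one]
    change c • Matrix.submatrix
      (1 : Matrix ((Fin N → K) × (Fin N → K)) ((Fin N → K) × (Fin N → K)) ℂ) _ _ = _
    rw [Matrix.submatrix_one_equiv]
  map_star' a := by
    simp only [topMatrix_eq, Matrix.star_eq_conjTranspose, Matrix.conjTranspose_submatrix,
      Matrix.conjTranspose_kronecker, Matrix.conjTranspose_one]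

/-- `bottomMatrix` as a homomorphism of *-algebras. -/
def bottomHom (N : ℕ) : Matrix (Fin N → K) (Fin N → K) ℂ →⋆ₐ[ℂ]
    Matrix (Fin N → K × K) (Fin N → K × K) ℂ where
  toFun := bottomMatrix
  map_one' := by simp [bottomMatrix_eq]
  map_mul' a b := by
    rw [bottomMatrix_eq, bottomMatrix_eq, bottomMatrix_eq, Matrix.submatrix_mul_equiv,
      ← Matrix.mul_kronecker_mul, one_mul]
  map_zero' := by ext; simp [bottomMatrix]
  map_add' a b := by ext; simp [bottomMatrix]; split_ifs <;> simp
  commutes' c := by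
    rw [Algebra.algebraMap_eq_smul_one, Algebra.algebraMap_eq_smul_one, bottomMatrix_eq,
      Matrix.kronecker_smul, Matrix.one_kronecker_one]
    change c • Matrix.submatrix
      (1 : Matrix ((Fin N → K) × (Fin N → K)) ((Fin N → K) × (Fin N → K)) ℂ) _ _ = _
    rw [Matrix.submatrix_one_equiv]
  map_star' a := by
    simp only [bottomMatrix_eq, Matrix.star_eq_conjTranspose, Matrix.conjTranspose_submatrix,
      Matrix.conjTranspose_kronecker, Matrix.conjTranspose_one]

theorem commute_topMatrix_bottomMatrix {N : ℕ} (a b : Matrix (Fin N → K) (Fin N → K) ℂ) :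
    Commute (topMatrix a) (bottomMatrix b) := by
  rw [commute_iff_eq, topMatrix_eq, bottomMatrix_eq, Matrix.submatrix_mul_equiv,
    Matrix.submatrix_mul_equiv, ← Matrix.mul_kronecker_mul, ← Matrix.mul_kronecker_mul]
  simp

omit [Fintype K] in
theorem topMatrix_extendMatrix {N : ℕ} (a : Matrix (Fin N → K) (Fin N → K) ℂ) :
    topMatrix (extendMatrix a) = extendMatrix (topMatrix a) := by
  ext s t
  have h : (∀ k, (s k).2 = (t k).2) ↔ (∀ k, (Fin.init s k).2 = (Fin.init t k).2) ∧
      (s (Fin.last N)).2 = (t (Fin.last N)).2 := Fin.forall_fin_succ'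
  simp only [topMatrix, extendMatrix, h, Prod.ext_iff]
  split_ifs <;> first | rfl | (exfalso; tauto)

omit [Fintype K] in
theorem bottomMatrix_extendMatrix {N : ℕ} (a : Matrix (Fin N → K) (Fin N → K) ℂ) :
    bottomMatrix (extendMatrix a) = extendMatrix (bottomMatrix a) := by
  ext s t
  have h : (∀ k, (s k).1 = (t k).1) ↔ (∀ k, (Fin.init s k).1 = (Fin.init t k).1) ∧
      (s (Fin.last N)).1 = (t (Fin.last N)).1 := Fin.forall_fin_succ'
  simp only [bottomMatrix, extendMatrix, h, Prod.ext_iff]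
  split_ifs <;> first | rfl | (exfalso; tauto)

/-! ### The two row representations and their action on the reference vector -/

variable {ref : Metric.sphere (0 : EuclideanSpace ℂ (K × K)) 1}

variable (ref) in
/-- The operators on the top row of the first `N` collections. -/
noncomputable def topRep (N : ℕ) :
    Matrix (Fin N → K) (Fin N → K) ℂ →⋆ₐ[ℂ] (ChainSpace ref →L[ℂ] ChainSpace ref) :=
  (localHom ref N).comp (topHom N)

variable (ref) in
/-- The operators on the bottom row of the first `N` collections. -/
noncomputable def bottomRep (N : ℕ) :
    Matrix (Fin N → K) (Fin N → K) ℂ →⋆ₐ[ℂ] (ChainSpace ref →L[ℂ] ChainSpace ref) :=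
  (localHom ref N).comp (bottomHom N)

theorem topRep_apply {N : ℕ} (a : Matrix (Fin N → K) (Fin N → K) ℂ) :
    topRep ref N a = localOp ref (topMatrix a) := rfl

theorem bottomRep_apply {N : ℕ} (a : Matrix (Fin N → K) (Fin N → K) ℂ) :
    bottomRep ref N a = localOp ref (bottomMatrix a) := rfl

theorem localAlgebra_topRep : localAlgebra (topRep ref) = topOps ref := by
  ext x
  simp only [localAlgebra, Set.mem_iUnion, Set.mem_range, topRep_apply]
  exact exists_congr fun N => exists_congr fun a => eq_comm

theorem localAlgebra_bottomRep : localAlgebra (bottomRep ref) = bottomOps ref := by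
  ext x
  simp only [localAlgebra, Set.mem_iUnion, Set.mem_range, bottomRep_apply]
  exact exists_congr fun N => exists_congr fun a => eq_comm

variable {c : ℂ}

theorem comp_preRefVector_apply
    (href : ∀ s, (ref : EuclideanSpace ℂ (K × K)) s = if s.1 = s.2 then c else 0) (N : ℕ)
    (s : Fin N → K × K) : PreSpace.comp N (preRefVector ref) s
      = if (fun k => (s k).1) = fun k => (s k).2 then c ^ N else 0 := by
  change ∏ k, (ref : EuclideanSpace ℂ (K × K)) (s k) = _
  simp only [href]
  rw [Finset.prod_ite_zero]
  simp [funext_iff]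

theorem sum_mul_ite_diagonal {N : ℕ} (F : (Fin N → K × K) → ℂ) (d : ℂ) :
    ∑ s, F s * (if (fun k => (s k).1) = fun k => (s k).2 then d else 0)
      = d * ∑ p : Fin N → K, F fun k => (p k, p k) := by
  rw [← (Equiv.arrowProdEquivProdArrow (Fin N) (fun _ => K) (fun _ => K)).symm.sum_comp,
    Fintype.sum_prod_type, Finset.mul_sum]
  refine Finset.sum_congr rfl fun p _ => ?_
  change ∑ q, F (fun k => (p k, q k)) * (if p = q then d else 0) = _
  simp [mul_comm]

/-- Vectorization: up to the factor c^N, the coefficients of aΩ are the entries of a, with row index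
on top and column index below. A bottom operator gives the transposed entries. -/
theorem comp_preOp_topMatrix
    (href : ∀ s, (ref : EuclideanSpace ℂ (K × K)) s = if s.1 = s.2 then c else 0) {N : ℕ}
    (a : Matrix (Fin N → K) (Fin N → K) ℂ) (s : Fin N → K × K) :
    PreSpace.comp N (preOp (topMatrix a) (preRefVector ref)) s
      = c ^ N * a (fun k => (s k).1) (fun k => (s k).2) := by
  rw [comp_preOp, finOp_apply _ le_rfl]
  simp only [overwrite_eq_left, comp_preRefVector_apply href]
  rw [sum_mul_ite_diagonal]
  simp [topMatrix, ← funext_iff]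

theorem comp_preOp_bottomMatrix
    (href : ∀ s, (ref : EuclideanSpace ℂ (K × K)) s = if s.1 = s.2 then c else 0) {N : ℕ}
    (a : Matrix (Fin N → K) (Fin N → K) ℂ) (s : Fin N → K × K) :
    PreSpace.comp N (preOp (bottomMatrix a) (preRefVector ref)) s
      = c ^ N * a (fun k => (s k).2) (fun k => (s k).1) := by
  rw [comp_preOp, finOp_apply _ le_rfl]
  simp only [overwrite_eq_left, comp_preRefVector_apply href]
  rw [sum_mul_ite_diagonal]
  simp [bottomMatrix, ← funext_iff]

theorem bottomRep_transpose_refVector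
    (href : ∀ s, (ref : EuclideanSpace ℂ (K × K)) s = if s.1 = s.2 then c else 0) {N : ℕ}
    (a : Matrix (Fin N → K) (Fin N → K) ℂ) :
    bottomRep ref N a.transpose (refVector ref) = topRep ref N a (refVector ref) := by
  rw [topRep_apply, bottomRep_apply, refVector, localOp_coe, localOp_coe]
  refine PreSpace.coe_eq_coe_of_comp_eq (comp_preOp_preRefVector _) (comp_preOp_preRefVector _) ?_
  ext s
  rw [comp_preOp_topMatrix href, comp_preOp_bottomMatrix href, Matrix.transpose_apply]

/-- The reference vector is supported on the diagonal, so the inner product sees only the diagonal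
entries of a. -/
theorem inner_topRep_refVector
    (href : ∀ s, (ref : EuclideanSpace ℂ (K × K)) s = if s.1 = s.2 then c else 0) {N : ℕ}
    (a : Matrix (Fin N → K) (Fin N → K) ℂ) :
    (inner ℂ (refVector ref) (topRep ref N a (refVector ref)) : ℂ)
      = star (c ^ N) * c ^ N * a.trace := by
  rw [topRep_apply, refVector, localOp_coe, UniformSpace.Completion.inner_coe,
    PreSpace.inner_eq_inner_comp (N := N) (fun n _ => comp_preRefVector n)
      (comp_preOp_preRefVector _), PiLp.inner_apply]
  simp only [RCLike.inner_apply, comp_preOp_topMatrix href, comp_preRefVector_apply href,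
    apply_ite (starRingEnd ℂ), map_zero]
  rw [sum_mul_ite_diagonal, ← Finset.mul_sum, ← mul_assoc]
  rfl

/-- The top and bottom rows of maximally entangled pairs form a tracial pair. -/
theorem isTracialPair_rows
    (href : ∀ s, (ref : EuclideanSpace ℂ (K × K)) s = if s.1 = s.2 then c else 0)
    (hK : 2 ≤ Fintype.card K) : IsTracialPair (refVector ref) (topRep ref) (bottomRep ref) where
  norm_eq_one := by
    -- With no collections the index set has one element and c^0 = 1, so the trace formula reads
    -- ‖Ω‖² = 1.
    have h := inner_topRep_refVector (N := 0) href 1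
    rw [map_one, one_apply_eq_self, inner_self_eq_norm_sq_to_K, Matrix.trace_one] at h
    have h' : (‖refVector ref‖ : ℂ) ^ 2 = 1 := by simpa using h
    exact (pow_eq_one_iff_of_nonneg (norm_nonneg _) two_ne_zero).1 (by exact_mod_cast h')
  exists_succ_left N a := ⟨extendMatrix a, by
    rw [topRep_apply, topRep_apply, topMatrix_extendMatrix, localOp_extendMatrix]⟩
  exists_succ_right N a := ⟨extendMatrix a, by
    rw [bottomRep_apply, bottomRep_apply, bottomMatrix_extendMatrix, localOp_extendMatrix]⟩
  commute N a b := (commute_topMatrix_bottomMatrix a b).map (localHom ref N)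
  exists_right N a := ⟨a.transpose, bottomRep_transpose_refVector href a⟩
  exists_left N b := ⟨b.transpose, by
    rw [← bottomRep_transpose_refVector href, Matrix.transpose_transpose]⟩
  dense := by
    have hc : c ≠ 0 := by
      rintro rfl
      have h0 : (ref : EuclideanSpace ℂ (K × K)) = 0 := by ext s; simp [href]
      have h1 := norm_eq_of_mem_sphere ref
      rw [h0, norm_zero] at h1
      exact zero_ne_one h1
    refine UniformSpace.Completion.denseRange_coe.mono ?_
    rintro _ ⟨f, rfl⟩
    obtain ⟨N, hN⟩ := eventually_atTop.1 f.eventually_comp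
    -- Inverse of the vectorization: the coefficients of `f` at a level where it has stabilized,
    -- read as a matrix and divided by c^N.
    refine ⟨N, Matrix.of fun p q => (c ^ N)⁻¹ * PreSpace.comp N f fun k => (p k, q k), ?_⟩
    rw [topRep_apply, refVector, localOp_coe]
    refine PreSpace.coe_eq_coe_of_comp_eq (comp_preOp_preRefVector _) hN ?_
    ext s
    rw [comp_preOp_topMatrix href, Matrix.of_apply, mul_inv_cancel_left₀ (pow_ne_zero N hc)]
  trace_left N := ⟨_, inner_topRep_refVector href⟩
  trace_right N := ⟨star (c ^ N) * c ^ N, fun a => by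
    rw [← Matrix.transpose_transpose a, bottomRep_transpose_refVector href,
      inner_topRep_refVector href, Matrix.transpose_transpose, Matrix.trace_transpose]⟩
  exists_lt_card m := ⟨m, by
    rw [Fintype.card_fun, Fintype.card_fin]
    exact (Nat.lt_two_pow_self).trans_le (Nat.pow_le_pow_left hK m)⟩

end Rows

/-! ### The code and physical reference vectors -/

theorem codeRef_apply (s : Fin 3 × Fin 3) : (codeRef : EuclideanSpace ℂ (Fin 3 × Fin 3)) s
    = if s.1 = s.2 then ((1 / √3 : ℝ) : ℂ) else 0 := rfl

/-- Two entangled qutrit pairs form one maximally entangled pair of nine-dimensional systems, so the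
physical case is another instance of the same construction. -/
theorem physRef_apply (s : (Fin 3 × Fin 3) × (Fin 3 × Fin 3)) :
    (physRef : EuclideanSpace ℂ ((Fin 3 × Fin 3) × (Fin 3 × Fin 3))) s
      = if s.1 = s.2 then ((1 / √3 : ℝ) : ℂ) * ((1 / √3 : ℝ) : ℂ) else 0 := by
  change (if s.1.1 = s.2.1 then ((1 / √3 : ℝ) : ℂ) else 0) *
    (if s.1.2 = s.2.2 then ((1 / √3 : ℝ) : ℂ) else 0) = _
  rw [ite_zero_mul_ite_zero]
  simp only [Prod.ext_iff]

theorem mainTheorem4 :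
    ∃ (Mcode : VonNeumannAlgebra CodeSpace) (Mphys : VonNeumannAlgebra PhysSpace),
      -- the algebras of the top rows, and their commutants
      (Mcode : Set (CodeSpace →L[ℂ] CodeSpace)) = strongClosure (topOps codeRef) ∧
      (Mphys : Set (PhysSpace →L[ℂ] PhysSpace)) = strongClosure (topOps physRef) ∧
      (Mcode.commutant : Set (CodeSpace →L[ℂ] CodeSpace)) = strongClosure (bottomOps codeRef) ∧
      (Mphys.commutant : Set (PhysSpace →L[ℂ] PhysSpace)) = strongClosure (bottomOps physRef) ∧
      -- all four algebras are factors
      IsFactor Mcode ∧ IsFactor Mcode.commutant ∧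
      IsFactor Mphys ∧ IsFactor Mphys.commutant ∧
      -- the reference vector state is the unique normal normalized trace, and it is faithful
      IsUniqueNormalTrace (vectorFunctional Mcode (refVector codeRef)) ∧
      IsUniqueNormalTrace (vectorFunctional Mcode.commutant (refVector codeRef)) ∧
      IsUniqueNormalTrace (vectorFunctional Mphys (refVector physRef)) ∧
      IsUniqueNormalTrace (vectorFunctional Mphys.commutant (refVector physRef)) ∧
      -- all four algebras are hyperfinite type II₁ factors
      (IsTypeII1Factor Mcode ∧ IsHyperfinite Mcode) ∧
      (IsTypeII1Factor Mcode.commutant ∧ IsHyperfinite Mcode.commutant) ∧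
      (IsTypeII1Factor Mphys ∧ IsHyperfinite Mphys) ∧
      (IsTypeII1Factor Mphys.commutant ∧ IsHyperfinite Mphys.commutant) := by
  obtain ⟨M, h1, h2, h3, h4, h5, h6, h7, h8⟩ :=
    (isTracialPair_rows codeRef_apply (by simp)).exists_algebra
  obtain ⟨P, p1, p2, p3, p4, p5, p6, p7, p8⟩ :=
    (isTracialPair_rows physRef_apply (by simp)).exists_algebra
  rw [localAlgebra_topRep] at h1 p1
  rw [localAlgebra_bottomRep] at h2 p2
  exact ⟨M, P, h1, p1, h2, p2, h3, h4, p3, p4, h5, h6, p5, p6, h7, h8, p7, p8⟩
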